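/- Let $q,x\in\mathbb{C}$ with $0<|q|<1$ and $x\neq 0$. Write $(a;q)_n=\prod_{i=0}^{n-1}(1-q^ia)$, $(a;q)_\infty=\prod_{i\ge 0}(1-q^ia)$, $(a,b;q)_n=(a;q)_n(b;q)_n$, $(a)_n=(a;q)_n$, $j(z;q)=(z;q)_\infty(q/z;q)_\infty(q;q)_\infty$, $J_{a,m}=j(q^a;q^m)$, $\overline{J}_{a,m}=j(-q^a;q^m)$, and let $$m(x,q,z)=\frac{1}{j(z;q)}\sum_{r\in\mathbb{Z}}\frac{(-1)^rq^{r(r-1)/2}z^r}{1-q^{r-1}xz}$$ be the Appell--Lerch sum. Then the following identities hold, where all the series on the left-hand sides of (1), (2), (4), (5) and the bilateral series that defines the starred sum in (3) converge absolutely, and $x$ avoids in each case exactly the values listed (at which a denominator of one of the two sides vanishes). (1) If $x\ne q^{2k+1}$ for all $k\in\mathbb{Z}$, then $$\Big(1+\frac1x\Big)\sum_{n=0}^{\infty}\frac{q^{n+1}(-q;q)_{2n}}{(qx,q/x;q^2)_{n+1}}=-m(x,q^2,q).$$ (2) If $x\ne -q^{k}$ for all $k\in\mathbb{Z}$, then $$\sum_{n=0}^{\infty}\frac{(-1)^nq^{n^2}(q;q^2)_n}{(-x;q^2)_{n+1}(-q^2/x;q^2)_n}=m(x,q,-1)+\frac{J_{1,2}^2}{2j(-x;q)}=2m(x,q,-1)-m(x,q,\sqrt{-q/x})$$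 for either choice of the square root; and if $x\ne \pm q^{2k}$ for all $k\in\mathbb{Z}$, then the same series equals $$m(-qx^2,q^4,-q^{-1})-q^{-1}x\,m(-q^{-1}x^2,q^4,-q).$$ (3) If $x\ne -q^{k}$ for all $k\in\mathbb{Z}$, then $$\sum_{n=0}^{\infty}{}^{\ast}\frac{(-1)^n(q;q^2)_n}{(-x)_{n+1}(-q/x)_n}=m(x,q,-1),$$ where the starred sum (the series itself does not converge) is defined to be $$\frac{1}{\overline{J}_{0,1}}\sum_{n\in\mathbb{Z}}\frac{(1+1/x)q^{n(n+1)/2}}{(1+xq^n)(1+q^n/x)}.$$ (4) If $x\ne -q^{k}$ for all $k\in\mathbb{Z}$, then $$\Big(1+\frac1x\Big)\sum_{n=0}^{\infty}\frac{(-1)^n(q;q^2)_nq^{(n+1)^2}}{(-xq,-q/x;q^2)_{n+1}}=m(x,q,-1)-\frac{J_{1,2}^2}{2j(-x;q)}.$$ (5) If $x\ne -q^{4k}$ and $x\ne q^{2k+1}$ for all $k\in\mathbb{Z}$, then $$\sum_{n=0}^{\infty}\frac{(-1)^nq^{2n^2}(q^2;q^4)_n}{(-x;q^4)_{n+1}(-q^4/x;q^4)_n}=m(x,q^2,q)+\frac{\overline{J}_{1,4}^2\,j(-xq^2;q^4)}{j(-x;q^4)\,j(xq;q^2)}.$$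 -/

import Mathlib

noncomputable section

namespace AppellLerch

/-- The finite `q`-shifted factorial `(x;q)_n = ∏_{i=0}^{n-1} (1 - q^i x)`. -/
def qPoch (x q : ℂ) (n : ℕ) : ℂ :=
  ∏ i ∈ Finset.range n, (1 - q ^ i * x)

/-- The infinite `q`-shifted factorial `(x;q)_∞ = ∏_{i ≥ 0} (1 - q^i x)`
(absolutely convergent for `|q| < 1`). -/
def qPochInf (x q : ℂ) : ℂ :=
  ∏' i : ℕ, (1 - q ^ i * x)

/-- The theta function `j(x;q) = (x;q)_∞ (q/x;q)_∞ (q;q)_∞`. -/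
def theta (x q : ℂ) : ℂ :=
  qPochInf x q * qPochInf (q / x) q * qPochInf q q

/-- `J_{a,m} = j(q^a;q^m)`. -/
def J (a : ℤ) (m : ℕ) (q : ℂ) : ℂ :=
  theta (q ^ a) (q ^ m)

/-- `\overline{J}_{a,m} = j(-q^a;q^m)`. -/
def Jbar (a : ℤ) (m : ℕ) (q : ℂ) : ℂ :=
  theta (-q ^ a) (q ^ m)

/-- The Appell--Lerch sum
`m(x,q,z) = j(z;q)⁻¹ ∑_{r ∈ ℤ} (-1)^r q^{r(r-1)/2} z^r / (1 - q^{r-1} x z)`.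
The integer division `r * (r - 1) / 2` is exact; for `0 < |q| < 1` and `x, z ≠ 0` the bilateral
series converges absolutely as soon as none of its denominators vanishes. -/
def m (x q z : ℂ) : ℂ :=
  1 / theta z q *
    ∑' r : ℤ, (-1) ^ r * q ^ (r * (r - 1) / 2) * z ^ r / (1 - q ^ (r - 1) * x * z)

/-- The general term `(1 + 1/x) q^{n(n+1)/2} / ((1 + x q^n) (1 + q^n / x))` of the bilateral series
which gives its value to the starred sum. -/
def starTerm (x q : ℂ) (n : ℤ) : ℂ :=
  (1 + 1 / x) * q ^ (n * (n + 1) / 2) / ((1 + x * q ^ n) * (1 + q ^ n / x))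

/-- The starred sum `∑^* (-1)^n (q;q^2)_n / ((-x;q)_{n+1} (-q/x;q)_n)`. The series itself does not
converge; the symbol denotes, by definition,
`\overline{J}_{0,1}⁻¹ ∑_{n ∈ ℤ} (1 + 1/x) q^{n(n+1)/2} / ((1 + x q^n) (1 + q^n / x))`. -/
def starSum (x q : ℂ) : ℂ :=
  1 / Jbar 0 1 q * ∑' n : ℤ, starTerm x q n

/-- General term of
`∑_{n ≥ 0} q^{n+1} (-q;q)_{2n} / ((qx;q^2)_{n+1} (q/x;q^2)_{n+1})`. -/
def term₁ (x q : ℂ) (n : ℕ) : ℂ :=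
  q ^ (n + 1) * qPoch (-q) q (2 * n) /
    (qPoch (q * x) (q ^ 2) (n + 1) * qPoch (q / x) (q ^ 2) (n + 1))

/-- General term of
`∑_{n ≥ 0} (-1)^n q^{n^2} (q;q^2)_n / ((-x;q^2)_{n+1} (-q^2/x;q^2)_n)`. -/
def term₂ (x q : ℂ) (n : ℕ) : ℂ :=
  (-1) ^ n * q ^ (n ^ 2) * qPoch q (q ^ 2) n /
    (qPoch (-x) (q ^ 2) (n + 1) * qPoch (-q ^ 2 / x) (q ^ 2) n)

/-- General term of
`∑_{n ≥ 0} (-1)^n (q;q^2)_n q^{(n+1)^2} / ((-xq;q^2)_{n+1} (-q/x;q^2)_{n+1})`. -/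
def term₄ (x q : ℂ) (n : ℕ) : ℂ :=
  (-1) ^ n * qPoch q (q ^ 2) n * q ^ ((n + 1) ^ 2) /
    (qPoch (-x * q) (q ^ 2) (n + 1) * qPoch (-q / x) (q ^ 2) (n + 1))

/-- General term of
`∑_{n ≥ 0} (-1)^n q^{2n^2} (q^2;q^4)_n / ((-x;q^4)_{n+1} (-q^4/x;q^4)_n)`. -/
def term₅ (x q : ℂ) (n : ℕ) : ℂ :=
  (-1) ^ n * q ^ (2 * n ^ 2) * qPoch (q ^ 2) (q ^ 4) n /
    (qPoch (-x) (q ^ 4) (n + 1) * qPoch (-q ^ 4 / x) (q ^ 4) n)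

end AppellLerch

end

open Filter Topology

namespace AppellLerch

/-! Each Eulerian series is turned into a bilateral Lerch-type sum, which is then recognised as an
Appell–Lerch sum up to theta functions. Two classical tools do the work.

The first is partial fractions. A truncated theta product `(u;p)_M (p/u;p)_N` is a monomial times a
finite product of linear factors, so Lagrange interpolation expands a quotient of such products.
Letting the truncation grow, by dominated convergence, gives `theta_partial_fractions` for quotients
of theta functions with more factors below than above. Already at finite level the case of one
factor below and none above (`inv_thetaTrunc_eq_tsum`) expands the denominator of the `n`th Eulerian
term over its poles. Exchanging the sums (`tsum_div_thetaTrunc`) leaves, at each pole `r`, a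
coefficient that is a sum over `n` free of `x`.

The second is the `q`-Gauss sum `tsum_gaussTerm`, which evaluates all these coefficients in closed
form (`term₁_coeff`, `term₂_coeff`, `term₄_coeff`). For `term₁` and `term₄` the bilateral sum has
two factors in its denominator; the prefactor `1 + 1/x` splits them, and the part independent of `x`
cancels under `r ↦ -1 - r` (`tsum_split`).

For `term₁` this is at once `-m x (q ^ 2) q`. The series of `term₂` and `term₄` become `2 / theta
(-1) q` times the even and odd halves of the Lerch series of `m x q (-1)`. The sum of the halves
gives `m x q (-1)`, while their difference is the expansion of `1 / theta (-x) q`, that is, the `J`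
term; hence the opposite signs in those two identities. The square root form comes from the change
of `z` in `m_sub_m`. Multiplying numerator and denominator of the even half by `1 - x q^(2r)` gives
the form in base `q ^ 4`.

The starred sum agrees with the Lerch series after symmetrisation under `n ↦ -n`. Finally `term₅` is
`term₂` in base `q ^ 2`, and its even half is one of the three pole families of a theta quotient
whose other two make up `m x (q ^ 2) q`. -/

/-! ### Finite and infinite `q`-shifted factorials -/

theorem qPoch_zero (x q : ℂ) : qPoch x q 0 = 1 := by simp [qPoch]

theorem qPoch_succ (x q : ℂ) (n : ℕ) : qPoch x q (n + 1) = qPoch x q n * (1 - q ^ n * x) := by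
  simp [qPoch, Finset.prod_range_succ]

theorem qPoch_add (x q : ℂ) (m n : ℕ) :
    qPoch x q (m + n) = qPoch x q m * qPoch (q ^ m * x) q n := by
  simp only [qPoch, Finset.prod_range_add]
  congr 1
  exact Finset.prod_congr rfl fun i _ => by ring

theorem qPoch_succ' (x q : ℂ) (n : ℕ) : qPoch x q (n + 1) = (1 - x) * qPoch (q * x) q n := by
  rw [add_comm, qPoch_add]; simp [qPoch]

theorem qPoch_ne_zero {x q : ℂ} (h : ∀ i : ℕ, q ^ i * x ≠ 1) (n : ℕ) : qPoch x q n ≠ 0 :=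
  Finset.prod_ne_zero_iff.mpr fun i _ => sub_ne_zero.mpr (h i).symm

theorem summable_norm_pow_mul {q : ℂ} (hq : ‖q‖ < 1) (x : ℂ) :
    Summable fun i : ℕ => ‖-(q ^ i * x)‖ := by
  simp only [norm_neg, norm_mul, norm_pow]
  exact (summable_geometric_of_lt_one (norm_nonneg _) hq).mul_right _

theorem multipliable_qPoch {q : ℂ} (hq : ‖q‖ < 1) (x : ℂ) :
    Multipliable fun i : ℕ => 1 - q ^ i * x := by
  simpa only [sub_eq_add_neg] using multipliable_one_add_of_summable (summable_norm_pow_mul hq x)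

theorem tendsto_qPoch {q : ℂ} (hq : ‖q‖ < 1) (x : ℂ) :
    Tendsto (qPoch x q) atTop (𝓝 (qPochInf x q)) :=
  (multipliable_qPoch hq x).tendsto_prod_tprod_nat

theorem qPochInf_ne_zero {x q : ℂ} (hq : ‖q‖ < 1) (h : ∀ i : ℕ, q ^ i * x ≠ 1) :
    qPochInf x q ≠ 0 := by
  have := tprod_one_add_ne_zero_of_summable (f := fun i : ℕ => -(q ^ i * x))
    (fun i => by rw [← sub_eq_add_neg]; exact sub_ne_zero.mpr (h i).symm)
    (summable_norm_pow_mul hq x)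
  simpa only [qPochInf, sub_eq_add_neg] using this

theorem qPochInf_eq_mul {q : ℂ} (hq : ‖q‖ < 1) (x : ℂ) (n : ℕ) :
    qPochInf x q = qPoch x q n * qPochInf (q ^ n * x) q := by
  refine tendsto_nhds_unique ((tendsto_qPoch hq x).comp (tendsto_add_atTop_nat n)) ?_
  have : (qPoch x q ∘ fun a => a + n) = fun a => qPoch x q n * qPoch (q ^ n * x) q a := by
    funext a
    simp [add_comm a n, qPoch_add]
  rw [this]
  exact (tendsto_qPoch hq _).const_mul _

theorem bounded_of_tendsto {f : ℕ → ℂ} {l : ℂ} (h : Tendsto f atTop (𝓝 l)) :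
    ∃ C : ℝ, 0 < C ∧ ∀ n, ‖f n‖ ≤ C := by
  obtain ⟨C, hC⟩ := (Metric.isBounded_range_of_tendsto f h).exists_norm_le
  exact ⟨max C 1, by positivity, fun n => (hC _ ⟨n, rfl⟩).trans (le_max_left _ _)⟩

theorem exists_qPoch_le {q : ℂ} (hq : ‖q‖ < 1) (x : ℂ) :
    ∃ C : ℝ, 0 < C ∧ ∀ n, ‖qPoch x q n‖ ≤ C :=
  bounded_of_tendsto (tendsto_qPoch hq x)

/-- The sequence of inverses converges because the infinite product is nonzero. Such uniform bounds
feed all the dominated convergence arguments below. -/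
theorem exists_inv_qPoch_le {x q : ℂ} (hq : ‖q‖ < 1) (h : ∀ i : ℕ, q ^ i * x ≠ 1) :
    ∃ C : ℝ, 0 < C ∧ ∀ n, ‖(qPoch x q n)⁻¹‖ ≤ C :=
  bounded_of_tendsto ((tendsto_qPoch hq x).inv₀ (qPochInf_ne_zero hq h))

theorem pow_mul_self_ne_one {q : ℂ} (hq : ‖q‖ < 1) (i : ℕ) : q ^ i * q ≠ 1 := by
  intro h
  have h2 := congrArg norm h
  rw [← pow_succ, norm_pow, norm_one] at h2
  exact (pow_lt_one₀ (norm_nonneg _) hq i.succ_ne_zero).ne h2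

theorem norm_pow_lt_one {q : ℂ} (hq : ‖q‖ < 1) {n : ℕ} (hn : n ≠ 0) : ‖q ^ n‖ < 1 := by
  rw [norm_pow]; exact pow_lt_one₀ (norm_nonneg _) hq hn

theorem qPochInf_even_mul_odd {q : ℂ} (hq : ‖q‖ < 1) (x : ℂ) :
    qPochInf x q = qPochInf x (q ^ 2) * qPochInf (q * x) (q ^ 2) := by
  have hq2 := norm_pow_lt_one hq two_ne_zero
  have h := tprod_even_mul_odd (f := fun i : ℕ => 1 - q ^ i * x)
    (by simpa only [pow_mul] using multipliable_qPoch hq2 x)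
    (by simpa only [pow_succ, pow_mul, mul_assoc] using multipliable_qPoch hq2 (q * x))
  rw [qPochInf, ← h]
  simp only [qPochInf, pow_succ, pow_mul, mul_assoc]

theorem qPochInf_mul_neg {q : ℂ} (hq : ‖q‖ < 1) (x : ℂ) :
    qPochInf x q * qPochInf (-x) q = qPochInf (x ^ 2) (q ^ 2) := by
  rw [qPochInf, qPochInf, ← (multipliable_qPoch hq x).tprod_mul (multipliable_qPoch hq (-x)),
    qPochInf]
  congr 1
  funext i
  ring

theorem qPochInf_self_ne_zero {q : ℂ} (hq : ‖q‖ < 1) : qPochInf q q ≠ 0 :=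
  qPochInf_ne_zero hq (pow_mul_self_ne_one hq)

/-- Euler's identity `(-q;q)_∞ (q;q^2)_∞ = 1`. -/
theorem qPochInf_neg_mul_odd {q : ℂ} (hq : ‖q‖ < 1) :
    qPochInf (-q) q * qPochInf q (q ^ 2) = 1 := by
  have h1 := qPochInf_mul_neg hq q
  have h2 := qPochInf_even_mul_odd hq q
  have h0 := qPochInf_self_ne_zero hq
  have h3 := qPochInf_self_ne_zero (norm_pow_lt_one hq two_ne_zero)
  rw [← pow_two] at h2
  rw [h2] at h1
  apply mul_right_cancel₀ h3
  linear_combination h1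

/-! ### Triangular numbers and the quasi-periodicity of theta -/

/-- The triangular numbers `r (r + 1) / 2`, for an integer `r`. -/
def tri (r : ℤ) : ℤ := r * (r + 1) / 2

theorem two_mul_tri (r : ℤ) : 2 * tri r = r * (r + 1) :=
  Int.mul_ediv_cancel' (Int.even_mul_succ_self r).two_dvd

theorem tri_add (a b : ℤ) : tri (a + b) = tri a + tri b + a * b := by
  have h1 := two_mul_tri (a + b)
  have h2 := two_mul_tri a
  have h3 := two_mul_tri b
  have : 2 * tri (a + b) = 2 * (tri a + tri b + a * b) := by
    linear_combination h1 - h2 - h3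
  exact mul_left_cancel₀ two_ne_zero this

theorem tri_neg (a : ℤ) : tri (-a) = tri a - a := by
  have h1 := two_mul_tri (-a)
  have h2 := two_mul_tri a
  have : 2 * tri (-a) = 2 * (tri a - a) := by
    linear_combination h1 - h2
  exact mul_left_cancel₀ two_ne_zero this

theorem tri_zero : tri 0 = 0 := rfl

theorem tri_one : tri 1 = 1 := rfl

theorem tri_nonneg (r : ℤ) : 0 ≤ tri r := by
  have h := two_mul_tri r
  rcases le_or_gt 0 r with h0 | h0 <;> nlinarith

/-- The truncated theta product `(x;p)_M (p/x;p)_N`. -/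
noncomputable def thetaTrunc (M N : ℕ) (x p : ℂ) : ℂ := qPoch x p M * qPoch (p / x) p N

theorem tendsto_thetaTrunc {p : ℂ} (hp : ‖p‖ < 1) (x : ℂ) :
    Tendsto (fun N => thetaTrunc (N + 1) N x p) atTop (𝓝 (qPochInf x p * qPochInf (p / x) p)) :=
  ((tendsto_qPoch hp x).comp (tendsto_add_atTop_nat 1)).mul (tendsto_qPoch hp _)

/-- Dividing the argument by `p` moves one factor from one half of the product to the other. This is
the unit step of the quasi-periodicity, exact at finite level. -/
theorem thetaTrunc_div {p u : ℂ} (hp : p ≠ 0) (hu : u ≠ 0) (M N : ℕ) :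
    thetaTrunc (M + 1) N (u / p) p = -u / p * thetaTrunc M (N + 1) u p := by
  have h : p / (u / p) = p * (p / u) := by field_simp
  rw [thetaTrunc, thetaTrunc, qPoch_succ', h, qPoch_succ', mul_div_cancel₀ _ hp]
  field_simp
  ring

theorem thetaTrunc_shift_nat {p : ℂ} (hp : p ≠ 0) (n : ℕ) {u : ℂ} (hu : u ≠ 0) (M N : ℕ) :
    thetaTrunc (M + n) N (u * p ^ (-n : ℤ)) p
      = (-u) ^ (n : ℤ) * p ^ (-tri n) * thetaTrunc M (N + n) u p := by
  induction n generalizing M N with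
  | zero => simp [tri_zero]
  | succ n ih =>
    have h : u * p ^ (-(n + 1 : ℕ) : ℤ) = u * p ^ (-n : ℤ) / p := by
      push_cast
      rw [neg_add, zpow_add₀ hp, zpow_neg_one]
      field_simp
    rw [h, ← add_assoc, thetaTrunc_div hp (mul_ne_zero hu (zpow_ne_zero _ hp)), ih M (N + 1)]
    push_cast
    rw [tri_add, tri_one, zpow_add₀ (neg_ne_zero.mpr hu), zpow_one, show N + 1 + n = N + (n + 1) by ring,
      show -(tri n + 1 + (n : ℤ) * 1) = -tri n + (-1) + -n by ring, zpow_add₀ hp, zpow_add₀ hp,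
      zpow_neg_one]
    ring

theorem thetaTrunc_shift {p u : ℂ} (hp : p ≠ 0) (hu : u ≠ 0) (r : ℤ) {M N M' N' : ℕ}
    (hM : (M' : ℤ) = M - r) (hN : (N' : ℤ) = N + r) :
    thetaTrunc M N (u * p ^ (-r)) p = (-u) ^ r * p ^ (-tri r) * thetaTrunc M' N' u p := by
  obtain ⟨n, rfl | rfl⟩ := r.eq_nat_or_neg
  · obtain rfl : M = M' + n := by omega
    obtain rfl : N' = N + n := by omega
    exact thetaTrunc_shift_nat hp n hu M' N
  · obtain rfl : M' = M + n := by omega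
    obtain rfl : N = N' + n := by omega
    have hv : u * p ^ (n : ℤ) ≠ 0 := mul_ne_zero hu (zpow_ne_zero _ hp)
    have h := thetaTrunc_shift_nat hp n hv M N'
    rw [mul_assoc, ← zpow_add₀ hp, add_neg_cancel, zpow_zero, mul_one] at h
    rw [h, neg_neg, ← neg_mul, mul_zpow, ← zpow_mul, tri_neg]
    have h1 : (-u) ^ (-(n : ℤ)) * (-u) ^ (n : ℤ) = 1 := by
      rw [← zpow_add₀ (neg_ne_zero.mpr hu)]; simp
    have h2 : p ^ (-(tri n - n)) * (p ^ ((n : ℤ) * n) * p ^ (-tri n)) = 1 := by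
      rw [← zpow_add₀ hp, ← zpow_add₀ hp]
      have : -(tri n - n) + ((n : ℤ) * n + -tri n) = 0 := by linarith [two_mul_tri n]
      rw [this, zpow_zero]
    linear_combination (-thetaTrunc M (N' + n) (u * p ^ (n : ℤ)) p) * (h1 * (p ^ (-(tri n - n)) *
      (p ^ ((n : ℤ) * n) * p ^ (-tri n))) + h2)

theorem theta_shift {p u : ℂ} (hp : p ≠ 0) (hp1 : ‖p‖ < 1) (hu : u ≠ 0) (r : ℤ) :
    theta (u * p ^ (-r)) p = (-u) ^ r * p ^ (-tri r) * theta u p := by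
  have key : qPochInf (u * p ^ (-r)) p * qPochInf (p / (u * p ^ (-r))) p
      = (-u) ^ r * p ^ (-tri r) * (qPochInf u p * qPochInf (p / u) p) := by
    refine tendsto_nhds_unique (tendsto_thetaTrunc hp1 _) ?_
    have h1 : Tendsto (fun N : ℕ => ((N : ℤ) + 1 - r).toNat) atTop atTop :=
      tendsto_atTop.mpr fun b => by
        filter_upwards [eventually_ge_atTop (b + r.toNat)] with N hN
        omega
    have h2 : Tendsto (fun N : ℕ => ((N : ℤ) + r).toNat) atTop atTop :=
      tendsto_atTop.mpr fun b => by
        filter_upwards [eventually_ge_atTop (b + (-r).toNat)] with N hN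
        omega
    have h3 := (((tendsto_qPoch hp1 u).comp h1).mul ((tendsto_qPoch hp1 (p / u)).comp h2)).const_mul
      ((-u) ^ r * p ^ (-tri r))
    refine h3.congr' ?_
    filter_upwards [eventually_ge_atTop r.natAbs] with N hN
    rw [thetaTrunc_shift hp hu r (M := N + 1) (N := N) (M' := ((N : ℤ) + 1 - r).toNat)
      (N' := ((N : ℤ) + r).toNat) (by omega) (by omega)]
    rfl
  rw [theta, key, theta]
  ring

theorem theta_div {x p : ℂ} (hp : p ≠ 0) : theta (p / x) p = theta x p := by
  rw [theta, theta, div_div_cancel₀ hp]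
  ring

theorem theta_ne_zero {x p : ℂ} (hx : x ≠ 0) (hp : p ≠ 0) (hp1 : ‖p‖ < 1)
    (h : ∀ k : ℤ, x ≠ p ^ k) : theta x p ≠ 0 := by
  refine mul_ne_zero (mul_ne_zero (qPochInf_ne_zero hp1 fun i hi => h (-i) ?_)
    (qPochInf_ne_zero hp1 fun i hi => h (i + 1) ?_)) (qPochInf_self_ne_zero hp1)
  · rw [zpow_neg, zpow_natCast]; exact eq_inv_of_mul_eq_one_right hi
  · rw [zpow_add₀ hp, zpow_natCast, zpow_one]
    field_simp at hi
    linear_combination -hi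

/-! ### Truncated theta products as finite bilateral products -/

theorem prod_Ico_int_up {f : ℤ → ℂ} {a b : ℤ} (n : ℕ) (h : b = a + n) :
    ∏ s ∈ Finset.Ico a b, f s = ∏ i ∈ Finset.range n, f (a + i) := by
  subst h
  refine Finset.prod_nbij' (fun s => (s - a).toNat) (fun i => a + i) ?_ ?_ ?_ ?_ ?_ <;>
    intro s hs <;> simp at hs ⊢ <;> try omega
  congr 1; omega

theorem prod_Ico_int_down {f : ℤ → ℂ} {a b : ℤ} (n : ℕ) (h : a = b - n) :
    ∏ s ∈ Finset.Ico a b, f s = ∏ i ∈ Finset.range n, f (b + (-1 - i)) := by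
  subst h
  refine Finset.prod_nbij' (fun s => (b - 1 - s).toNat) (fun i => b + (-1 - i)) ?_ ?_ ?_ ?_ ?_ <;>
    intro s hs <;> simp at hs ⊢ <;> try omega
  congr 1; omega

theorem prod_one_sub_mul_zpow_neg {p y : ℂ} (hp : p ≠ 0) (hy : y ≠ 0) (N : ℕ) :
    ∏ i ∈ Finset.range N, (1 - y * p ^ (-1 - i : ℤ))
      = (-1) ^ N * y ^ (N : ℤ) * p ^ (-tri N) * qPoch (p / y) p N := by
  induction N with
  | zero => simp [tri_zero, qPoch]
  | succ N ih =>
    rw [Finset.prod_range_succ, ih, qPoch_succ]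
    push_cast
    rw [tri_add, tri_one, zpow_add₀ hy, zpow_one, pow_succ,
      show -(tri N + 1 + (N : ℤ) * 1) = -tri N + (-1 - N) by ring, zpow_add₀ hp]
    have h : p ^ (-1 - N : ℤ) * p ^ N * p = 1 := by
      rw [← zpow_natCast, ← zpow_add₀ hp, ← zpow_add_one₀ hp]; simp
    have h' : p ^ (-1 - N : ℤ) * (p ^ N * (p / y)) * y = 1 := by
      rw [← h]; field_simp
    linear_combination ((-1) ^ N * y ^ (N : ℤ) * p ^ (-tri N) * qPoch (p / y) p N) * (-h')

/-- Turning the factors of `(p/y;p)_N` inside out, `1 - p^(i+1)/y = -(p^(i+1)/y)(1 - y p^(-1-i))`,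
continues the product of the `1 - y p^s` to negative `s`. -/
theorem thetaTrunc_eq_prod {p y : ℂ} (hp : p ≠ 0) (hy : y ≠ 0) (M N : ℕ) :
    thetaTrunc M N y p = (-1) ^ N * p ^ tri N * y ^ (-N : ℤ) *
      ∏ s ∈ Finset.Ico (-N : ℤ) M, (1 - y * p ^ s) := by
  have h1 : ∏ s ∈ Finset.Ico (-N : ℤ) M, (1 - y * p ^ s)
      = (∏ s ∈ Finset.Ico (-N : ℤ) 0, (1 - y * p ^ s)) * ∏ s ∈ Finset.Ico (0 : ℤ) M, (1 - y * p ^ s) := by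
    rw [← Finset.prod_union (Finset.Ico_disjoint_Ico_consecutive _ _ _),
      Finset.Ico_union_Ico_eq_Ico (by omega) (by omega)]
  rw [h1, prod_Ico_int_down N (by omega), prod_Ico_int_up M (by omega)]
  simp only [zero_add]
  rw [prod_one_sub_mul_zpow_neg hp hy, thetaTrunc, qPoch, qPoch]
  simp only [zpow_natCast, zpow_neg, mul_comm y]
  generalize ∏ i ∈ Finset.range M, (1 - p ^ i * y) = A
  generalize ∏ i ∈ Finset.range N, (1 - p ^ i * (p / y)) = B
  have h2 : ((-1 : ℂ) ^ N) * (-1) ^ N = 1 := by rw [← mul_pow]; simp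
  have h3 := mul_inv_cancel₀ (zpow_ne_zero (tri N) hp)
  have h4 := inv_mul_cancel₀ (pow_ne_zero N hy)
  calc A * B = ((-1) ^ N * (-1) ^ N) * (p ^ tri N * (p ^ tri N)⁻¹) * ((y ^ N)⁻¹ * y ^ N) * A * B := by
        rw [h2, h3, h4]; ring
    _ = _ := by ring

/-- This is the residue factor at the pole `y = p^(-r)`: the factors on either side of the removed
one form two finite factorials. -/
theorem prod_erase_one_sub_zpow {p : ℂ} (hp : p ≠ 0) {M N M' N' : ℕ} {r : ℤ}
    (hM : (M' : ℤ) = M - 1 - r) (hN : (N' : ℤ) = N + r) :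
    (-1) ^ N * p ^ tri N * (p ^ (-r)) ^ (-N : ℤ) *
      ∏ s ∈ (Finset.Ico (-N : ℤ) M).erase r, (1 - p ^ (-r) * p ^ s)
      = (-1) ^ r * p ^ (-tri r) * (qPoch p p M' * qPoch p p N') := by
  have h1 : (Finset.Ico (-N : ℤ) M).erase r = Finset.Ico (-N : ℤ) r ∪ Finset.Ico (r + 1) M := by
    ext s; simp; omega
  have h2 : Disjoint (Finset.Ico (-N : ℤ) r) (Finset.Ico (r + 1) M) := by
    rw [Finset.disjoint_left]; intro s; simp; omega
  rw [h1, Finset.prod_union h2, prod_Ico_int_down N' (by omega), prod_Ico_int_up M' (by omega)]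
  have h3 : ∏ i ∈ Finset.range N', (1 - p ^ (-r) * p ^ (r + (-1 - i : ℤ)))
      = (-1) ^ N' * p ^ (-tri N') * qPoch p p N' := by
    have := prod_one_sub_mul_zpow_neg hp one_ne_zero N'
    rw [one_zpow, div_one, mul_one] at this
    rw [← this]
    refine Finset.prod_congr rfl fun i _ => ?_
    rw [← zpow_add₀ hp, neg_add_cancel_left, one_mul]
  have h4 : ∏ i ∈ Finset.range M', (1 - p ^ (-r) * p ^ (r + 1 + i : ℤ)) = qPoch p p M' := by
    refine Finset.prod_congr rfl fun i _ => ?_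
    rw [← zpow_add₀ hp, ← pow_succ, ← zpow_natCast]
    congr 2; push_cast; ring
  rw [h3, h4, hN, ← zpow_mul]
  have h5 : ((-1 : ℂ)) ^ N * (-1) ^ N' = (-1) ^ r := by
    rw [← zpow_natCast, ← zpow_natCast, hN, ← zpow_add₀ (by norm_num),
      show (N : ℤ) + (N + r) = 2 * N + r by ring, zpow_add₀ (by norm_num), zpow_mul]
    simp
  have h6 : p ^ tri N * p ^ (-r * -(N : ℤ)) * p ^ (-tri (N + r)) = p ^ (-tri r) := by
    rw [← zpow_add₀ hp, ← zpow_add₀ hp, tri_add]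
    congr 1; ring
  rw [← h5, ← h6]
  ring

/-! ### Partial fractions for quotients of theta functions -/

open Polynomial in
/-- Partial fractions with simple poles at the points `(v i)⁻¹`. -/
theorem partial_fractions {ι : Type*} [DecidableEq ι] (s : Finset ι) (v : ι → ℂ)
    (hv0 : ∀ i ∈ s, v i ≠ 0) (hv : Set.InjOn v s) (P : ℂ[X]) (hP : P.degree < s.card) {x : ℂ}
    (hx : ∀ i ∈ s, 1 - v i * x ≠ 0) :
    P.eval x / ∏ i ∈ s, (1 - v i * x)
      = ∑ i ∈ s, P.eval (v i)⁻¹ / (∏ j ∈ s.erase i, (1 - v j * (v i)⁻¹)) / (1 - v i * x) := by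
  have hw : Set.InjOn (fun i => (v i)⁻¹) s := fun i hi j hj h => hv hi hj (inv_injective h)
  conv_lhs => rw [Lagrange.eq_interpolate hw hP]
  rw [Lagrange.interpolate_apply, Polynomial.eval_finsetSum, Finset.sum_div]
  refine Finset.sum_congr rfl fun i hi => ?_
  have hb : (Lagrange.basis s (fun i => (v i)⁻¹) i).eval x
      = (∏ j ∈ s.erase i, (1 - v j * x)) / ∏ j ∈ s.erase i, (1 - v j * (v i)⁻¹) := by
    rw [Lagrange.basis, Polynomial.eval_prod, ← Finset.prod_div_distrib]
    refine Finset.prod_congr rfl fun j hj => ?_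
    have hj' := Finset.mem_erase.mp hj
    have hvj := hv0 j hj'.2
    have hvi := hv0 i hi
    have hne : v i - v j ≠ 0 := sub_ne_zero.mpr fun h => hj'.1 (hv hi hj'.2 h).symm
    have hne' : v j - v i ≠ 0 := sub_ne_zero.mpr fun h => hj'.1 (hv hj'.2 hi h)
    simp only [Lagrange.basisDivisor, eval_mul, eval_C, eval_sub, eval_X]
    have h1 : (v i)⁻¹ - (v j)⁻¹ = (v j - v i) / (v i * v j) := by field_simp
    have h2 : 1 - v j * (v i)⁻¹ = (v i - v j) / v i := by field_simp
    rw [h1, h2]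
    field_simp
    ring
  rw [eval_mul, eval_C, hb, ← Finset.mul_prod_erase s _ hi]
  have h1 := hx i hi
  have h2 : ∏ j ∈ s.erase i, (1 - v j * x) ≠ 0 :=
    Finset.prod_ne_zero_iff.mpr fun j hj => hx j (Finset.mem_of_mem_erase hj)
  generalize ∏ j ∈ s.erase i, (1 - v j * x) = A at h2 ⊢
  field_simp

theorem prod_product_erase {ι σ : Type*} [Fintype ι] [DecidableEq ι] [DecidableEq σ]
    (I : Finset σ) (f : ι × σ → ℂ) (i : ι) (r : σ) :
    ∏ n ∈ (Finset.univ ×ˢ I).erase (i, r), f n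
      = (∏ s ∈ I.erase r, f (i, s)) * ∏ j ∈ Finset.univ.erase i, ∏ s ∈ I, f (j, s) := by
  have h1 : (Finset.univ ×ˢ I).erase (i, r)
      = ({i} ×ˢ I.erase r) ∪ ((Finset.univ.erase i) ×ˢ I) := by
    ext ⟨j, s⟩
    by_cases h : j = i
    · simp [h]
    · simp [h]
      tauto
  have h2 : Disjoint ({i} ×ˢ I.erase r) ((Finset.univ.erase i) ×ˢ I) := by
    rw [Finset.disjoint_left]
    rintro ⟨j, s⟩
    simp +contextual
  rw [h1, Finset.prod_union h2, Finset.prod_product, Finset.prod_product, Finset.prod_singleton]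

open Polynomial in
/-- Partial fractions of a quotient of truncated theta products. -/
theorem thetaTrunc_partial_fractions {ι κ : Type*} [Fintype ι] [Fintype κ] [DecidableEq ι] {p : ℂ}
    (hp : p ≠ 0) (hp1 : ‖p‖ < 1) {a : ι → ℂ} {b : κ → ℂ} (ha : ∀ i, a i ≠ 0) (hb : ∀ k, b k ≠ 0)
    (hcard : Fintype.card κ < Fintype.card ι)
    (hdist : ∀ i j, i ≠ j → ∀ k : ℤ, a i ≠ a j * p ^ k) {x : ℂ} (hx : x ≠ 0)
    (hax : ∀ i, ∀ k : ℤ, a i * x * p ^ k ≠ 1) {M : ℕ} (N : ℕ) (hM : 0 < M) :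
    (∏ k, thetaTrunc M N (b k * x) p) / ∏ i, thetaTrunc M N (a i * x) p
      = ∑ i, ∑ r ∈ Finset.Ico (-N : ℤ) M,
        (∏ k, thetaTrunc M N (b k / a i * p ^ (-r)) p) /
          (∏ j ∈ Finset.univ.erase i, thetaTrunc M N (a j / a i * p ^ (-r)) p) /
          ((-1) ^ r * p ^ (-tri r) * (qPoch p p (M - 1 - r).toNat * qPoch p p (N + r).toNat)) /
          (1 - a i * x * p ^ r) := by
  set I := Finset.Ico (-N : ℤ) M with hI
  -- `K` is the monomial prefactor of `thetaTrunc_eq_prod`. It is kept opaque so that it can be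
  -- cancelled as a block.
  obtain ⟨K, hK⟩ : ∃ K : ℂ → ℂ, ∀ y, K y = (-1) ^ N * p ^ tri N * y ^ (-N : ℤ) :=
    ⟨_, fun _ => rfl⟩
  have hK0 : ∀ {y}, y ≠ 0 → K y ≠ 0 := fun {y} hy => by
    rw [hK]
    exact mul_ne_zero (mul_ne_zero (by simp) (zpow_ne_zero _ hp)) (zpow_ne_zero _ hy)
  have hT : ∀ y, y ≠ 0 → thetaTrunc M N y p = K y * ∏ s ∈ I, (1 - y * p ^ s) :=
    fun y hy => by rw [hK]; exact thetaTrunc_eq_prod hp hy M N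
  have hinj : Function.Injective fun n : ℤ => p ^ n := by
    intro m n h
    have h2 := congrArg norm h
    simp only [norm_zpow] at h2
    exact zpow_right_injective₀ (norm_pos_iff.mpr hp) hp1.ne h2
  set v : ι × ℤ → ℂ := fun n => a n.1 * p ^ n.2 with hv
  have hv0 : ∀ n, v n ≠ 0 := fun n => mul_ne_zero (ha _) (zpow_ne_zero _ hp)
  have hvinj : Function.Injective v := by
    rintro ⟨i, r⟩ ⟨j, s⟩ h
    simp only [hv] at h
    by_cases hij : i = j
    · subst hij
      exact Prod.ext rfl (hinj (mul_left_cancel₀ (ha i) h))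
    · refine absurd ?_ (hdist i j hij (s - r))
      rw [zpow_sub₀ hp, mul_div_assoc', ← h, mul_div_cancel_right₀ _ (zpow_ne_zero _ hp)]
  obtain ⟨d, hd⟩ := Nat.exists_eq_add_of_lt hcard
  -- The power of `X` absorbs the quotient of the prefactors `K`, there being `d + 1` more theta
  -- factors below than above. The degree stays below the number of poles because `M > 0`.
  set P : ℂ[X] := X ^ (N * (d + 1)) * ∏ k, ∏ s ∈ I, (1 - C (b k * p ^ s) * X) with hP
  have hPdeg : P.degree < (Finset.univ ×ˢ I : Finset (ι × ℤ)).card := by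
    have h1 : P.natDegree ≤ N * (d + 1) + Fintype.card κ * (M + N) := by
      refine natDegree_mul_le.trans (add_le_add (natDegree_X_pow_le _) ?_)
      refine (natDegree_prod_le _ _).trans ?_
      rw [← smul_eq_mul, ← Finset.card_univ]
      refine Finset.sum_le_card_nsmul _ _ _ fun k _ => (natDegree_prod_le _ _).trans ?_
      have hIc : I.card = M + N := by simp [hI]; omega
      refine (Finset.sum_le_card_nsmul _ _ 1 fun s _ => ?_).trans_eq (by simp [hIc])
      compute_degree
    refine (degree_le_of_natDegree_le h1).trans_lt ?_
    rw [Finset.card_product, Finset.card_univ, hd]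
    have hIc : I.card = M + N := by simp [hI]; omega
    rw [hIc]
    have : N * (d + 1) + Fintype.card κ * (M + N) < (Fintype.card κ + d + 1) * (M + N) := by
      nlinarith
    exact_mod_cast this
  have hPe : ∀ y, P.eval y = y ^ (N * (d + 1)) * ∏ k, ∏ s ∈ I, (1 - b k * y * p ^ s) := by
    intro y
    simp only [hP, eval_mul, eval_pow, eval_X, eval_prod, eval_sub, eval_one, eval_C]
    congr 1
    exact Finset.prod_congr rfl fun k _ => Finset.prod_congr rfl fun s _ => by ring
  obtain ⟨c, hc⟩ : ∃ c : ℂ, ∀ y, y ≠ 0 →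
      (∏ k, K (b k * y)) / ∏ i, K (a i * y) = c * y ^ (N * (d + 1)) := by
    refine ⟨(∏ k, K (b k)) / ∏ i, K (a i), fun y hy => ?_⟩
    have h1 : ∀ z, K (z * y) = K z * y ^ (-N : ℤ) := fun z => by
      simp only [hK, mul_zpow]; ring
    simp only [h1, Finset.prod_mul_distrib, Finset.prod_const, Finset.card_univ]
    have h2 : (∏ i, K (a i)) ≠ 0 := Finset.prod_ne_zero_iff.mpr fun i _ => hK0 (ha i)
    rw [hd]
    simp only [zpow_neg, zpow_natCast, inv_pow, ← pow_mul]
    rw [show N * (Fintype.card κ + d + 1) = N * Fintype.card κ + N * (d + 1) by ring, pow_add]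
    generalize N * (d + 1) = e
    field_simp
  have hR : ∀ y, y ≠ 0 → ∏ k, thetaTrunc M N (b k * y) p = c * P.eval y * ∏ i, K (a i * y) := by
    intro y hy
    have h2 : (∏ i, K (a i * y)) ≠ 0 :=
      Finset.prod_ne_zero_iff.mpr fun i _ => hK0 (mul_ne_zero (ha i) hy)
    have h3 := hc y hy
    rw [div_eq_iff h2] at h3
    rw [Finset.prod_congr rfl fun k _ => hT _ (mul_ne_zero (hb k) hy), Finset.prod_mul_distrib, h3,
      hPe]
    ring
  have h1 := partial_fractions (Finset.univ ×ˢ I) v (fun n _ => hv0 n) hvinj.injOn P hPdeg (x := x)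
    (fun n _ => sub_ne_zero.mpr fun h => hax n.1 n.2 (by rw [h]; simp only [hv]; ring))
  have h2 : (∏ i, K (a i * x)) ≠ 0 :=
    Finset.prod_ne_zero_iff.mpr fun i _ => hK0 (mul_ne_zero (ha i) hx)
  rw [hR x hx, Finset.prod_congr rfl fun i _ => hT _ (mul_ne_zero (ha i) hx),
    Finset.prod_mul_distrib, mul_comm (c * _), mul_div_mul_left _ _ h2, mul_div_assoc]
  have h3 : ∏ i, ∏ s ∈ I, (1 - a i * x * p ^ s) = ∏ n ∈ Finset.univ ×ˢ I, (1 - v n * x) := by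
    rw [Finset.prod_product]
    exact Finset.prod_congr rfl fun i _ => Finset.prod_congr rfl fun s _ => by simp only [hv]; ring
  rw [h3, h1, Finset.sum_product, Finset.mul_sum]
  refine Finset.sum_congr rfl fun i _ => ?_
  rw [Finset.mul_sum]
  refine Finset.sum_congr rfl fun r hr => ?_
  have hr' := Finset.mem_Ico.mp hr
  have hw : (v (i, r))⁻¹ = p ^ (-r) / a i := by simp only [hv, zpow_neg]; field_simp
  have hw0 : p ^ (-r) / a i ≠ 0 := div_ne_zero (zpow_ne_zero _ hp) (ha i)
  have hpr : p ^ (-r) ≠ 0 := zpow_ne_zero _ hp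
  have h4 := hR _ hw0
  rw [← Finset.mul_prod_erase _ _ (Finset.mem_univ i), mul_div_cancel₀ _ (ha i)] at h4
  have h5 := prod_erase_one_sub_zpow hp (M := M) (N := N) (M' := (M - 1 - r).toNat)
    (N' := (N + r).toNat) (r := r) (by omega) (by omega)
  rw [← hK] at h5
  rw [← h5, prod_product_erase I _ i, hw]
  have h6 : ∏ s ∈ I.erase r, (1 - v (i, s) * (p ^ (-r) / a i))
      = ∏ s ∈ I.erase r, (1 - p ^ (-r) * p ^ s) :=
    Finset.prod_congr rfl fun s _ => by
      have := ha i
      simp only [hv]; field_simp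
  have h7 : ∏ j ∈ Finset.univ.erase i, thetaTrunc M N (a j / a i * p ^ (-r)) p
      = (∏ j ∈ Finset.univ.erase i, K (a j * (p ^ (-r) / a i))) *
        ∏ j ∈ Finset.univ.erase i, ∏ s ∈ I, (1 - v (j, s) * (p ^ (-r) / a i)) := by
    rw [← Finset.prod_mul_distrib]
    refine Finset.prod_congr rfl fun j _ => ?_
    rw [show a j / a i * p ^ (-r) = a j * (p ^ (-r) / a i) by ring, hT _ (mul_ne_zero (ha j) hw0)]
    congr 1
    exact Finset.prod_congr rfl fun s _ => by simp only [hv]; ring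
  have h8 : ∏ k, thetaTrunc M N (b k / a i * p ^ (-r)) p
      = ∏ k, thetaTrunc M N (b k * (p ^ (-r) / a i)) p :=
    Finset.prod_congr rfl fun k _ => by congr 1; ring
  have h9 : (∏ j ∈ Finset.univ.erase i, K (a j * (p ^ (-r) / a i))) ≠ 0 :=
    Finset.prod_ne_zero_iff.mpr fun j _ => hK0 (mul_ne_zero (ha j) hw0)
  have h10 : K (p ^ (-r)) ≠ 0 := hK0 hpr
  rw [h8, h4, h7, h6, show v (i, r) * x = a i * x * p ^ r by simp only [hv]; ring]
  generalize ∏ j ∈ Finset.univ.erase i, K (a j * (p ^ (-r) / a i)) = A at h9 ⊢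
  generalize ∏ s ∈ I.erase r, (1 - p ^ (-r) * p ^ s) = B
  generalize ∏ j ∈ Finset.univ.erase i, ∏ s ∈ I, (1 - v (j, s) * (p ^ (-r) / a i)) = D
  generalize K (p ^ (-r)) = E at h10 ⊢
  rw [mul_div_assoc', mul_div_assoc', div_div (c * eval _ P * (E * A)),
    show c * eval (p ^ (-r) / a i) P * (E * A) = (E * A) * (c * eval (p ^ (-r) / a i) P) by ring,
    show A * D * (E * B) = (E * A) * (B * D) by ring,
    mul_div_mul_left _ _ (mul_ne_zero h10 h9)]

theorem summable_nat_zpow_tri {p : ℝ} (hp : 0 < p) (hp1 : p < 1) {ρ : ℝ} (hρ : 0 < ρ) :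
    Summable fun n : ℕ => ρ ^ n * p ^ tri n := by
  refine summable_of_ratio_test_tendsto_lt_one zero_lt_one (Eventually.of_forall fun n => by positivity) ?_
  have h : ∀ n : ℕ, ‖ρ ^ (n + 1) * p ^ tri (n + 1 : ℕ)‖ / ‖ρ ^ n * p ^ tri n‖ = ρ * p * p ^ n := by
    intro n
    rw [Real.norm_of_nonneg (by positivity), Real.norm_of_nonneg (by positivity)]
    push_cast
    rw [tri_add, tri_one, mul_one, zpow_add₀ hp.ne', zpow_add₀ hp.ne', zpow_natCast, zpow_one, pow_succ]
    have := zpow_ne_zero (tri n) hp.ne'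
    field_simp
  simp only [h]
  simpa using (tendsto_pow_atTop_nhds_zero_of_lt_one hp.le hp1).const_mul (ρ * p)

theorem summable_zpow_tri {p : ℝ} (hp : 0 < p) (hp1 : p < 1) {ρ : ℝ} (hρ : 0 < ρ) :
    Summable fun r : ℤ => ρ ^ r * p ^ tri r := by
  refine Summable.of_nat_of_neg ?_ ?_
  · simpa using summable_nat_zpow_tri hp hp1 hρ
  · refine (summable_nat_zpow_tri hp hp1 (ρ := (ρ * p)⁻¹) (by positivity)).congr fun n => ?_
    rw [tri_neg, sub_eq_add_neg, zpow_add₀ hp.ne', zpow_neg, zpow_neg, zpow_natCast, zpow_natCast,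
      mul_inv, mul_pow, inv_pow, inv_pow]
    ring

/-- The inverses tend to `1` as `r → ∞` and to `0` as `r → -∞`. A vanishing denominator does no
harm, since its inverse is `0` by convention. -/
theorem exists_inv_one_sub_le {p x : ℂ} (hp : p ≠ 0) (hp1 : ‖p‖ < 1) (hx : x ≠ 0) :
    ∃ C : ℝ, 0 < C ∧ ∀ r : ℤ, ‖(1 - x * p ^ r)⁻¹‖ ≤ C := by
  have h0 := tendsto_pow_atTop_nhds_zero_of_norm_lt_one hp1
  have h1 : Tendsto (fun n : ℕ => (1 - x * p ^ n)⁻¹) atTop (𝓝 1) := by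
    have := ((h0.const_mul x).const_sub 1).inv₀ (by simp)
    simpa using this
  have h2 : Tendsto (fun n : ℕ => (1 - x * p ^ (-n : ℤ))⁻¹) atTop (𝓝 0) := by
    have h3 : Tendsto (fun n : ℕ => p ^ n * (p ^ n - x)⁻¹) atTop (𝓝 0) := by
      have := h0.mul ((h0.sub_const x).inv₀ (by simpa using hx))
      simpa using this
    refine h3.congr fun n => ?_
    have hpn := pow_ne_zero n hp
    rw [zpow_neg, zpow_natCast, show 1 - x * (p ^ n)⁻¹ = (p ^ n - x) / p ^ n by field_simp, inv_div,
      div_eq_mul_inv]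
  obtain ⟨C, hC, hC'⟩ := bounded_of_tendsto h1
  obtain ⟨D, hD, hD'⟩ := bounded_of_tendsto h2
  refine ⟨max C D, by positivity, fun r => ?_⟩
  obtain ⟨n, rfl | rfl⟩ := r.eq_nat_or_neg
  · rw [zpow_natCast]; exact (hC' n).trans (le_max_left _ _)
  · exact (hD' n).trans (le_max_right _ _)

theorem summable_lerch {p x w : ℂ} (hp : p ≠ 0) (hp1 : ‖p‖ < 1) (hx : x ≠ 0) (hw : w ≠ 0)
    {e : ℤ} (he : 0 < e) :
    Summable fun r : ℤ => ‖(-1) ^ r * p ^ (tri r * e) * w ^ r / (1 - x * p ^ r)‖ := by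
  obtain ⟨C, hC, hC'⟩ := exists_inv_one_sub_le hp hp1 hx
  have hp0 : 0 < ‖p‖ := norm_pos_iff.mpr hp
  have hw0 : 0 < ‖w‖ := norm_pos_iff.mpr hw
  refine Summable.of_nonneg_of_le (fun _ => norm_nonneg _) (fun r => ?_)
    ((summable_zpow_tri hp0 hp1 hw0).mul_right C)
  rw [div_eq_mul_inv, norm_mul, norm_mul, norm_mul, norm_zpow, norm_zpow, norm_zpow, norm_neg,
    norm_one, one_zpow, one_mul, mul_comm (‖p‖ ^ _)]
  have h1 : ‖p‖ ^ (tri r * e) ≤ ‖p‖ ^ tri r :=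
    zpow_le_zpow_right_of_le_one₀ hp0 hp1.le (le_mul_of_one_le_right (tri_nonneg r) he)
  gcongr
  exact hC' r

theorem exists_thetaTrunc_le {p : ℂ} (hp1 : ‖p‖ < 1) (u : ℂ) :
    ∃ C : ℝ, 0 < C ∧ ∀ m n, ‖thetaTrunc m n u p‖ ≤ C := by
  obtain ⟨C, hC, hC'⟩ := exists_qPoch_le hp1 u
  obtain ⟨D, hD, hD'⟩ := exists_qPoch_le hp1 (p / u)
  refine ⟨C * D, by positivity, fun m n => ?_⟩
  rw [thetaTrunc, norm_mul]
  exact mul_le_mul (hC' m) (hD' n) (norm_nonneg _) hC.le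

theorem pow_mul_ne_one {p u : ℂ} (h : ∀ k : ℤ, u ≠ p ^ k) (i : ℕ) : p ^ i * u ≠ 1 := fun hi =>
  h (-i) (by rw [zpow_neg, zpow_natCast]; exact eq_inv_of_mul_eq_one_right hi)

theorem pow_mul_div_ne_one {p u : ℂ} (hp : p ≠ 0) (hu : u ≠ 0) (h : ∀ k : ℤ, u ≠ p ^ k) (i : ℕ) :
    p ^ i * (p / u) ≠ 1 := fun hi => h (i + 1) (by
  rw [zpow_add₀ hp, zpow_natCast, zpow_one]
  field_simp at hi
  linear_combination -hi)

theorem exists_inv_thetaTrunc_le {p u : ℂ} (hp : p ≠ 0) (hp1 : ‖p‖ < 1) (hu : u ≠ 0)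
    (h : ∀ k : ℤ, u ≠ p ^ k) : ∃ C : ℝ, 0 < C ∧ ∀ m n, ‖(thetaTrunc m n u p)⁻¹‖ ≤ C := by
  obtain ⟨C, hC, hC'⟩ := exists_inv_qPoch_le hp1 (pow_mul_ne_one h)
  obtain ⟨D, hD, hD'⟩ := exists_inv_qPoch_le hp1 (pow_mul_div_ne_one hp hu h)
  refine ⟨C * D, by positivity, fun m n => ?_⟩
  rw [thetaTrunc, mul_inv, norm_mul]
  exact mul_le_mul (hC' m) (hD' n) (norm_nonneg _) hC.le

theorem qPoch_self_ne_zero {p : ℂ} (hp1 : ‖p‖ < 1) (n : ℕ) : qPoch p p n ≠ 0 :=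
  qPoch_ne_zero (pow_mul_self_ne_one hp1) n

theorem tendsto_toNat_sub (r : ℤ) (c : ℤ) : Tendsto (fun N : ℕ => ((N : ℤ) + c - r).toNat) atTop atTop :=
  tendsto_atTop.mpr fun b => by
    filter_upwards [eventually_ge_atTop (b + r.toNat + (-c).toNat)] with N hN
    omega

theorem tendsto_toNat_add (r : ℤ) : Tendsto (fun N : ℕ => ((N : ℤ) + r).toNat) atTop atTop := by
  simpa using tendsto_toNat_sub 0 r

/-- Partial fractions of a quotient of theta functions. -/
theorem theta_partial_fractions {ι κ : Type*} [Fintype ι] [Fintype κ] [DecidableEq ι] {p : ℂ}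
    (hp : p ≠ 0) (hp1 : ‖p‖ < 1) {a : ι → ℂ} {b : κ → ℂ} (ha : ∀ i, a i ≠ 0) (hb : ∀ k, b k ≠ 0)
    (hcard : Fintype.card κ < Fintype.card ι)
    (hdist : ∀ i j, i ≠ j → ∀ k : ℤ, a i ≠ a j * p ^ k) {x : ℂ} (hx : x ≠ 0)
    (hax : ∀ i, ∀ k : ℤ, a i * x * p ^ k ≠ 1) :
    (∏ k, theta (b k * x) p) / ∏ i, theta (a i * x) p
      = ∑ i, (∏ k, theta (b k / a i) p) / (∏ j ∈ Finset.univ.erase i, theta (a j / a i) p) /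
          qPochInf p p ^ 3 * ∑' r : ℤ, (-1) ^ r * p ^ (tri r * (Fintype.card ι - Fintype.card κ)) *
          ((∏ k, -(b k / a i)) / ∏ j ∈ Finset.univ.erase i, -(a j / a i)) ^ r /
            (1 - a i * x * p ^ r) := by
  have hE := qPochInf_self_ne_zero hp1
  have hba : ∀ i k, b k / a i ≠ 0 := fun i k => div_ne_zero (hb k) (ha i)
  have haa : ∀ i j, a j / a i ≠ 0 := fun i j => div_ne_zero (ha j) (ha i)
  have hq : ∀ i, ∀ j ∈ Finset.univ.erase i, ∀ k : ℤ, a j / a i ≠ p ^ k := fun i j hj k h =>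
    hdist j i (Finset.mem_erase.mp hj).1 k (by rw [← h, mul_div_cancel₀ _ (ha i)])
  set Θ : ℂ → ℂ := fun u => qPochInf u p * qPochInf (p / u) p with hΘ
  have hθ : ∀ u, theta u p = Θ u * qPochInf p p := fun u => rfl
  have hΘ0 : ∀ u, u ≠ 0 → (∀ k : ℤ, u ≠ p ^ k) → Θ u ≠ 0 := fun u h1 h2 =>
    left_ne_zero_of_mul (theta_ne_zero h1 hp hp1 h2)
  set W : ι → ℤ → ℂ := fun i r => (-1) ^ r * p ^ (tri r * (Fintype.card ι - Fintype.card κ)) *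
    ((∏ k, -(b k / a i)) / ∏ j ∈ Finset.univ.erase i, -(a j / a i)) ^ r / (1 - a i * x * p ^ r)
    with hW
  -- `T` is what remains of a truncated product at argument `u p^(-r)` after the shift factor is
  -- pulled out. `A` collects these remainders with the residue factorials; its limit `B` does not
  -- depend on `r`, so only `W` carries the dependence on `r`.
  set T : ℕ → ℤ → ℂ → ℂ := fun N r u =>
    thetaTrunc ((N : ℤ) + 1 - r).toNat ((N : ℤ) + r).toNat u p with hT
  set A : ℕ → ι → ℤ → ℂ := fun N i r => (∏ k, T N r (b k / a i)) *
    (∏ j ∈ Finset.univ.erase i, (T N r (a j / a i))⁻¹) *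
    ((qPoch p p ((N : ℤ) + 0 - r).toNat)⁻¹ * (qPoch p p ((N : ℤ) + r).toNat)⁻¹) with hA
  set B : ι → ℂ := fun i => (∏ k, Θ (b k / a i)) * (∏ j ∈ Finset.univ.erase i, (Θ (a j / a i))⁻¹) *
    ((qPochInf p p)⁻¹ * (qPochInf p p)⁻¹) with hB
  have hWsum : ∀ i, Summable fun r => ‖W i r‖ := fun i => by
    refine summable_lerch hp hp1 (mul_ne_zero (ha i) hx) (div_ne_zero ?_ ?_) (by omega)
    · exact Finset.prod_ne_zero_iff.mpr fun k _ => neg_ne_zero.mpr (hba i k)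
    · exact Finset.prod_ne_zero_iff.mpr fun j _ => neg_ne_zero.mpr (haa i j)
  have hTlim : ∀ r u, Tendsto (fun N => T N r u) atTop (𝓝 (Θ u)) := fun r u =>
    ((tendsto_qPoch hp1 u).comp (tendsto_toNat_sub r 1)).mul
      ((tendsto_qPoch hp1 (p / u)).comp (tendsto_toNat_add r))
  have hAlim : ∀ i r, Tendsto (fun N => A N i r) atTop (𝓝 (B i)) := fun i r => by
    refine ((tendsto_finsetProd _ fun k _ => hTlim r _).mul
      (tendsto_finsetProd _ fun j hj => (hTlim r _).inv₀ (hΘ0 _ (haa i j) (hq i j hj)))).mul ?_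
    exact (((tendsto_qPoch hp1 p).comp (tendsto_toNat_sub r 0)).inv₀ hE).mul
      (((tendsto_qPoch hp1 p).comp (tendsto_toNat_add r)).inv₀ hE)
  have hAbd : ∀ i, ∃ C : ℝ, ∀ N r, ‖A N i r‖ ≤ C := fun i => by
    choose C1 hC1 hC1' using fun k => exists_thetaTrunc_le hp1 (b k / a i)
    have : ∀ j : ι, ∃ C : ℝ, 0 < C ∧ (j ∈ Finset.univ.erase i →
        ∀ m n, ‖(thetaTrunc m n (a j / a i) p)⁻¹‖ ≤ C) := fun j => by
      by_cases hj : j ∈ Finset.univ.erase i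
      · obtain ⟨C, h1, h2⟩ := exists_inv_thetaTrunc_le hp hp1 (haa i j) (hq i j hj)
        exact ⟨C, h1, fun _ => h2⟩
      · exact ⟨1, one_pos, fun h => absurd h hj⟩
    choose C2 hC2 hC2' using this
    obtain ⟨C3, hC3, hC3'⟩ := exists_inv_qPoch_le hp1 (pow_mul_self_ne_one hp1)
    refine ⟨(∏ k, C1 k) * (∏ j ∈ Finset.univ.erase i, C2 j) * (C3 * C3), fun N r => ?_⟩
    simp only [hA, norm_mul, norm_prod]
    have h1 : ∏ k, ‖T N r (b k / a i)‖ ≤ ∏ k, C1 k :=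
      Finset.prod_le_prod (fun _ _ => norm_nonneg _) fun k _ => hC1' k _ _
    have h2 : ∏ j ∈ Finset.univ.erase i, ‖(T N r (a j / a i))⁻¹‖ ≤ ∏ j ∈ Finset.univ.erase i, C2 j :=
      Finset.prod_le_prod (fun _ _ => norm_nonneg _) fun j hj => hC2' j hj _ _
    have h3 : 0 ≤ ∏ k, C1 k := Finset.prod_nonneg fun k _ => (hC1 k).le
    have h4 : 0 ≤ ∏ j ∈ Finset.univ.erase i, C2 j := Finset.prod_nonneg fun k _ => (hC2 k).le
    gcongr
    · exact hC3' _
    · exact hC3' _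
  have hlim : ∀ i, Tendsto (fun N : ℕ => ∑ r ∈ Finset.Ico (-N : ℤ) (N + 1 : ℕ), A N i r * W i r) atTop
      (𝓝 (∑' r, B i * W i r)) := fun i => by
    obtain ⟨C, hC⟩ := hAbd i
    have hC0 : 0 ≤ C := (norm_nonneg _).trans (hC 0 0)
    -- The finite sum is extended by zero to all of `ℤ`; this also discards the indices where
    -- `toNat` truncates.
    have := tendsto_tsum_of_dominated_convergence (𝓕 := atTop)
      (f := fun (N : ℕ) r => if r ∈ Finset.Ico (-N : ℤ) (N + 1 : ℕ) then A N i r * W i r else 0)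
      (g := fun r => B i * W i r) ((hWsum i).mul_left C) (fun r => ?_) (Eventually.of_forall fun N r => ?_)
    · refine this.congr fun N => ?_
      rw [tsum_eq_sum (s := Finset.Ico (-N : ℤ) (N + 1 : ℕ)) fun r hr => by simp only [if_neg hr]]
      exact Finset.sum_congr rfl fun r hr => by simp only [if_pos hr]
    · refine ((hAlim i r).mul_const (W i r)).congr' ?_
      filter_upwards [eventually_ge_atTop r.natAbs] with N hN
      rw [if_pos (Finset.mem_Ico.mpr (by omega))]
    · split_ifs
      · rw [norm_mul]
        exact mul_le_mul_of_nonneg_right (hC N r) (norm_nonneg _)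
      · rw [norm_zero]; positivity
  have hfin : ∀ N : ℕ, (∏ k, thetaTrunc (N + 1) N (b k * x) p) / ∏ i, thetaTrunc (N + 1) N (a i * x) p
      = ∑ i, ∑ r ∈ Finset.Ico (-N : ℤ) (N + 1 : ℕ), A N i r * W i r := fun N => by
    rw [thetaTrunc_partial_fractions hp hp1 ha hb hcard hdist hx hax N N.succ_pos]
    refine Finset.sum_congr rfl fun i _ => Finset.sum_congr rfl fun r hr => ?_
    have hr' := Finset.mem_Ico.mp hr
    have hs : ∀ u, u ≠ 0 → thetaTrunc (N + 1) N (u * p ^ (-r)) p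
        = (-u) ^ r * p ^ (-tri r) * T N r u := fun u hu =>
      thetaTrunc_shift hp hu r (by omega) (by omega)
    rw [Finset.prod_congr rfl fun k _ => hs _ (hba i k), Finset.prod_congr rfl fun j _ => hs _ (haa i j)]
    simp only [Finset.prod_mul_distrib, Finset.prod_const, Finset.card_univ,
      Finset.card_erase_of_mem (Finset.mem_univ i), hA, hW, Finset.prod_inv_distrib, Finset.prod_zpow]
    rw [show ((N + 1 : ℕ) : ℤ) - 1 - r = N + 0 - r by push_cast; ring, div_zpow]
    obtain ⟨d, hd⟩ := Nat.exists_eq_add_of_lt hcard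
    -- Each theta factor contributes `p^(-tri r)` under the shift, and the residue one more below;
    -- the net exponent is the difference of the two cardinalities.
    have h1 : p ^ (tri r * (Fintype.card ι - Fintype.card κ)) * (p ^ (-tri r)) ^ (Fintype.card ι - 1)
        * p ^ (-tri r) = (p ^ (-tri r)) ^ Fintype.card κ := by
      rw [← zpow_natCast, ← zpow_natCast, ← zpow_mul, ← zpow_mul, ← zpow_add₀ hp, ← zpow_add₀ hp, hd]
      congr 1
      rw [Nat.add_sub_cancel]
      push_cast
      ring
    have h2 : ((-1 : ℂ) ^ r)⁻¹ = (-1) ^ r := by rw [← inv_zpow]; norm_num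
    have h3 := zpow_ne_zero (-tri r) hp
    have h4 := pow_ne_zero (Fintype.card ι - 1) h3
    rw [← h1]
    simp only [div_eq_mul_inv, mul_inv, h2]
    field_simp
  have hL : Tendsto (fun N => (∏ k, thetaTrunc (N + 1) N (b k * x) p) /
      ∏ i, thetaTrunc (N + 1) N (a i * x) p) atTop (𝓝 ((∏ k, Θ (b k * x)) / ∏ i, Θ (a i * x))) := by
    refine (tendsto_finsetProd _ fun k _ => tendsto_thetaTrunc hp1 _).div
      (tendsto_finsetProd _ fun i _ => tendsto_thetaTrunc hp1 _) ?_
    refine Finset.prod_ne_zero_iff.mpr fun i _ => hΘ0 _ (mul_ne_zero (ha i) hx) fun k h => ?_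
    exact hax i (-k) (by rw [h, ← zpow_add₀ hp, add_neg_cancel, zpow_zero])
  simp only [hfin] at hL
  have h := tendsto_nhds_unique hL (tendsto_finsetSum _ fun i _ => hlim i)
  simp only [tsum_mul_left] at h
  simp only [hθ, Finset.prod_mul_distrib, Finset.prod_const, Finset.card_univ,
    Finset.card_erase_of_mem (Finset.mem_univ _)]
  obtain ⟨d, hd⟩ := Nat.exists_eq_add_of_lt hcard
  rw [mul_div_mul_comm, h, Finset.sum_mul]
  refine Finset.sum_congr rfl fun i _ => ?_
  change _ = _ * ∑' r, W i r
  generalize ∑' r, W i r = S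
  simp only [hB, hd, Finset.prod_inv_distrib, Nat.add_sub_cancel]
  field_simp
  ring

/-! ### The `q`-Gauss summation -/

/-- The general term of the `q`-Gauss sum, homogenised so as to include its confluent case `z = 0`. -/
noncomputable def gaussTerm (a z b q : ℂ) (k : ℕ) : ℂ :=
  qPoch a q k * (∏ i ∈ Finset.range k, (z - b * q ^ i)) / (qPoch q q k * qPoch (a * b) q k)

theorem summable_prod_sub {q z : ℂ} (hq : ‖q‖ < 1) (hz : ‖z‖ < 1) (b : ℂ) :
    Summable fun k => ‖∏ i ∈ Finset.range k, (z - b * q ^ i)‖ := by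
  obtain ⟨ρ, h1, h2⟩ := exists_between hz
  refine summable_of_ratio_norm_eventually_le h2 ?_
  have h3 : Tendsto (fun k => ‖z - b * q ^ k‖) atTop (𝓝 ‖z‖) := by
    have := (((tendsto_pow_atTop_nhds_zero_of_norm_lt_one hq).const_mul b).const_sub z).norm
    simpa using this
  filter_upwards [h3.eventually_le_const h1] with k hk
  rw [norm_norm, norm_norm, Finset.prod_range_succ, norm_mul, mul_comm]
  exact mul_le_mul_of_nonneg_right hk (norm_nonneg _)

/-- The bound is uniform in `n` because `(q^n ab;q)_k` equals `(ab;q)_(n+k) / (ab;q)_n`, and scaling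
`z` and `b` by `q^n` pulls `q^(nk)` out of the product. -/
theorem exists_gaussTerm_le {a b q : ℂ} (hq : ‖q‖ < 1) (z : ℂ)
    (hab : ∀ i : ℕ, q ^ i * (a * b) ≠ 1) : ∃ C : ℝ, 0 < C ∧ ∀ n k : ℕ,
      ‖gaussTerm a (q ^ n * z) (q ^ n * b) q k‖
        ≤ C * ‖∏ i ∈ Finset.range k, (z - b * q ^ i)‖ * (‖q‖ ^ k) ^ n := by
  obtain ⟨C1, h1, h1'⟩ := exists_qPoch_le hq a
  obtain ⟨C2, h2, h2'⟩ := exists_inv_qPoch_le hq (pow_mul_self_ne_one hq)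
  obtain ⟨C3, h3, h3'⟩ := exists_inv_qPoch_le hq hab
  obtain ⟨C4, h4, h4'⟩ := exists_qPoch_le hq (a * b)
  refine ⟨C1 * (C2 * (C4 * C3)), by positivity, fun n k => ?_⟩
  have h5 : ∏ i ∈ Finset.range k, (q ^ n * z - q ^ n * b * q ^ i)
      = (q ^ k) ^ n * ∏ i ∈ Finset.range k, (z - b * q ^ i) := by
    rw [← pow_mul, mul_comm k n, pow_mul, ← Finset.card_range k, ← Finset.prod_const,
      Finset.card_range, ← Finset.prod_mul_distrib]
    exact Finset.prod_congr rfl fun i _ => by ring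
  have h6 : (qPoch (a * (q ^ n * b)) q k)⁻¹ = qPoch (a * b) q n * (qPoch (a * b) q (n + k))⁻¹ := by
    have := qPoch_ne_zero hab n
    rw [qPoch_add, show q ^ n * (a * b) = a * (q ^ n * b) by ring]
    field_simp
  rw [gaussTerm, h5, div_eq_mul_inv, mul_inv, h6]
  simp only [norm_mul, norm_pow]
  calc _ ≤ C1 * ((‖q‖ ^ k) ^ n * ‖∏ i ∈ Finset.range k, (z - b * q ^ i)‖) * (C2 * (C4 * C3)) := by
        gcongr
        · exact h1' k
        · exact h2' k
        · exact h4' n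
        · exact h3' _
    _ = _ := by ring

theorem summable_gaussTerm {a z b q : ℂ} (hq : ‖q‖ < 1) (hz : ‖z‖ < 1)
    (hab : ∀ i : ℕ, q ^ i * (a * b) ≠ 1) : Summable (gaussTerm a z b q) := by
  obtain ⟨C, -, hC⟩ := exists_gaussTerm_le hq z hab
  refine Summable.of_norm_bounded ((summable_prod_sub hq hz b).mul_left C) fun k => ?_
  simpa using hC 0 k

/-- A telescoping certificate: the two sides of the contiguous relation differ termwise by the
increment of `-(1 - ab)(1 - q^k)` times the `k`th term. This sequence vanishes at `k = 0` and tends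
to `0`. -/
theorem gaussTerm_contiguous {a b q : ℂ} (hq : ‖q‖ < 1) (z : ℂ)
    (hab : ∀ i : ℕ, q ^ i * (a * b) ≠ 1) (k : ℕ) :
    (1 - a * b) * (1 - z) * gaussTerm a z b q k
        - (1 - a * z) * (1 - b) * gaussTerm a (q * z) (q * b) q k
      = -(1 - a * b) * (1 - q ^ (k + 1)) * gaussTerm a z b q (k + 1)
        - -(1 - a * b) * (1 - q ^ k) * gaussTerm a z b q k := by
  have h1 : 1 - q ^ k * (a * b) ≠ 0 := sub_ne_zero.mpr (hab k).symm
  have h2 : 1 - q ^ k * q ≠ 0 := sub_ne_zero.mpr (pow_mul_self_ne_one hq k).symm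
  have h3 : 1 - a * b ≠ 0 := sub_ne_zero.mpr (by simpa using (hab 0).symm)
  have h4 : qPoch q q k ≠ 0 := qPoch_self_ne_zero hq k
  have h5 : qPoch (a * b) q k ≠ 0 := qPoch_ne_zero hab k
  have h6 : qPoch (a * (q * b)) q k = qPoch (a * b) q k * (1 - q ^ k * (a * b)) / (1 - a * b) := by
    rw [eq_div_iff h3, ← qPoch_succ, qPoch_succ', show q * (a * b) = a * (q * b) by ring, mul_comm]
  have h7 : ∏ i ∈ Finset.range k, (q * z - q * b * q ^ i)
      = q ^ k * ∏ i ∈ Finset.range k, (z - b * q ^ i) := by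
    rw [← Finset.card_range k, ← Finset.prod_const, Finset.card_range, ← Finset.prod_mul_distrib]
    exact Finset.prod_congr rfl fun i _ => by ring
  simp only [gaussTerm, h6, h7, qPoch_succ, Finset.prod_range_succ, pow_succ]
  generalize ∏ i ∈ Finset.range k, (z - b * q ^ i) = A
  generalize q ^ k = y at *
  have h8 : 1 - a * b * y ≠ 0 := by rwa [mul_comm (a * b)]
  field_simp
  ring

theorem tsum_gaussTerm_contiguous {a z b q : ℂ} (hq : ‖q‖ < 1) (hz : ‖z‖ < 1)
    (hab : ∀ i : ℕ, q ^ i * (a * b) ≠ 1) :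
    (1 - a * b) * (1 - z) * ∑' k, gaussTerm a z b q k
      = (1 - a * z) * (1 - b) * ∑' k, gaussTerm a (q * z) (q * b) q k := by
  have hz' : ‖q * z‖ < 1 := by
    rw [norm_mul]; exact mul_lt_one_of_nonneg_of_lt_one_left (norm_nonneg _) hq hz.le
  have hab' : ∀ i : ℕ, q ^ i * (a * (q * b)) ≠ 1 := fun i => by
    have := hab (i + 1)
    rwa [pow_succ, show q ^ i * q * (a * b) = q ^ i * (a * (q * b)) by ring] at this
  have s1 := summable_gaussTerm hq hz hab
  have s2 := summable_gaussTerm hq hz' hab'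
  have h1 := ((s1.hasSum.mul_left ((1 - a * b) * (1 - z))).sub
    (s2.hasSum.mul_left ((1 - a * z) * (1 - b)))).tendsto_sum_nat
  simp only [gaussTerm_contiguous hq z hab] at h1
  simp only [Finset.sum_range_sub (fun k => -(1 - a * b) * (1 - q ^ k) * gaussTerm a z b q k)] at h1
  have h2 : Tendsto (fun n : ℕ => -(1 - a * b) * (1 - q ^ n) * gaussTerm a z b q n
      - -(1 - a * b) * (1 - q ^ 0) * gaussTerm a z b q 0) atTop (𝓝 0) := by
    have := (((tendsto_pow_atTop_nhds_zero_of_norm_lt_one hq).const_sub 1).const_mul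
      (-(1 - a * b))).mul s1.tendsto_atTop_zero
    simpa using this
  exact sub_eq_zero.mp (tendsto_nhds_unique h1 h2)

/-- The `q`-Gauss summation. -/
theorem tsum_gaussTerm {a z b q : ℂ} (hq : ‖q‖ < 1) (hz : ‖z‖ < 1)
    (hab : ∀ i : ℕ, q ^ i * (a * b) ≠ 1) :
    qPochInf (a * b) q * qPochInf z q * ∑' k, gaussTerm a z b q k
      = qPochInf (a * z) q * qPochInf b q := by
  have hab' : ∀ n i : ℕ, q ^ i * (a * (q ^ n * b)) ≠ 1 := fun n i => by
    have := hab (i + n)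
    rwa [pow_add, show q ^ i * q ^ n * (a * b) = q ^ i * (a * (q ^ n * b)) by ring] at this
  have hz' : ∀ n : ℕ, ‖q ^ n * z‖ < 1 := fun n => by
    rw [norm_mul, norm_pow]
    exact (mul_le_of_le_one_left (norm_nonneg _) (pow_le_one₀ (norm_nonneg _) hq.le)).trans_lt hz
  have h1 : ∀ n : ℕ, qPoch (a * b) q n * qPoch z q n * ∑' k, gaussTerm a z b q k
      = qPoch (a * z) q n * qPoch b q n * ∑' k, gaussTerm a (q ^ n * z) (q ^ n * b) q k := fun n => by
    induction n with
    | zero => simp [qPoch_zero]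
    | succ n ih =>
      have := tsum_gaussTerm_contiguous hq (hz' n) (hab' n)
      simp only [qPoch_succ]
      rw [pow_succ', mul_assoc q, mul_assoc q]
      linear_combination ((1 - q ^ n * (a * b)) * (1 - q ^ n * z)) * ih +
        (qPoch (a * z) q n * qPoch b q n) * this
  -- After infinitely many contiguous steps `z` and `b` have shrunk to `0`, and only the term `k =
  -- 0` survives.
  have h2 : Tendsto (fun n : ℕ => ∑' k, gaussTerm a (q ^ n * z) (q ^ n * b) q k) atTop (𝓝 1) := by
    obtain ⟨C, hC0, hC⟩ := exists_gaussTerm_le hq z hab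
    have := tendsto_tsum_of_dominated_convergence (𝓕 := atTop)
      (f := fun (n : ℕ) k => gaussTerm a (q ^ n * z) (q ^ n * b) q k)
      (g := fun k => if k = 0 then 1 else 0) ((summable_prod_sub hq hz b).mul_left C) (fun k => ?_)
      (Eventually.of_forall fun n k => (hC n k).trans ?_)
    · simpa using this
    · split_ifs with hk
      · subst hk
        simp [gaussTerm, qPoch_zero]
      · refine squeeze_zero_norm (fun n => hC n k) ?_
        have := (tendsto_pow_atTop_nhds_zero_of_lt_one (pow_nonneg (norm_nonneg q) k)
          (pow_lt_one₀ (norm_nonneg _) hq hk)).const_mul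
            (C * ‖∏ i ∈ Finset.range k, (z - b * q ^ i)‖)
        simpa using this
    · exact mul_le_of_le_one_right (by positivity)
        (pow_le_one₀ (by positivity) (pow_le_one₀ (norm_nonneg _) hq.le))
  have h3 := ((tendsto_qPoch hq (a * b)).mul (tendsto_qPoch hq z)).mul_const
    (∑' k, gaussTerm a z b q k)
  have h4 := ((tendsto_qPoch hq (a * z)).mul (tendsto_qPoch hq b)).mul h2
  simp only [← h1, mul_one] at h4
  exact tendsto_nhds_unique h3 h4

/-! ### From Eulerian series to bilateral Lerch sums -/

/-- `1 / (p;p)_k`, which is `0` for `k < 0`. -/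
noncomputable def invFact (p : ℂ) (k : ℤ) : ℂ := if 0 ≤ k then (qPoch p p k.toNat)⁻¹ else 0

theorem invFact_natCast (p : ℂ) (k : ℕ) : invFact p k = (qPoch p p k)⁻¹ := by simp [invFact]

theorem exists_invFact_le {p : ℂ} (hp1 : ‖p‖ < 1) : ∃ C : ℝ, 0 < C ∧ ∀ k, ‖invFact p k‖ ≤ C := by
  obtain ⟨C, hC, hC'⟩ := exists_inv_qPoch_le hp1 (pow_mul_self_ne_one hp1)
  refine ⟨C, hC, fun k => ?_⟩
  rw [invFact]
  split_ifs
  · exact hC' _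
  · simpa using hC.le

/-- Partial fractions with a single theta factor below and none above. The zeros of `invFact` let
the finite sum over poles run over all of `ℤ`, which makes the range independent of `n`. -/
theorem inv_thetaTrunc_eq_tsum {p u : ℂ} (hp : p ≠ 0) (hp1 : ‖p‖ < 1) (hu : u ≠ 0)
    (h : ∀ k : ℤ, u * p ^ k ≠ 1) (n e : ℕ) :
    (qPoch u p (n + 1) * qPoch (p / u) p (n + e))⁻¹
      = ∑' r : ℤ, (-1) ^ r * p ^ tri r / (1 - u * p ^ r) * (invFact p (n - r) * invFact p (n + e + r)) := by
  have h1 := thetaTrunc_partial_fractions (ι := Unit) (κ := Empty) hp hp1 (a := fun _ => 1)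
    (b := fun _ => 1) (by simp) (by simp) (by simp) (by simp) hu (by simpa using h) (M := n + 1) (n + e)
    n.succ_pos
  simp only [Finset.univ_eq_empty, Finset.prod_empty, Finset.univ_unique, Finset.prod_singleton,
    Finset.sum_singleton, one_mul, one_div] at h1
  rw [thetaTrunc] at h1
  rw [h1, tsum_eq_sum (s := Finset.Ico (-(n + e : ℕ) : ℤ) (n + 1 : ℕ))]
  · refine Finset.sum_congr rfl fun r hr => ?_
    have hr' := Finset.mem_Ico.mp hr
    rw [invFact, invFact, if_pos (by omega), if_pos (by omega)]
    have h2 : ((-1 : ℂ) ^ r)⁻¹ = (-1) ^ r := by rw [← inv_zpow]; norm_num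
    rw [show ((n + 1 : ℕ) : ℤ) - 1 - r = n - r by push_cast; ring,
      show ((n + e : ℕ) : ℤ) + r = n + e + r by push_cast; ring]
    simp [zpow_neg, h2, div_eq_mul_inv]
    ring
  · intro r hr
    rw [Finset.mem_Ico] at hr
    by_cases h2 : 0 ≤ (n : ℤ) - r
    · rw [show invFact p (n + e + r) = 0 from if_neg (by omega)]; simp
    · rw [invFact, if_neg h2]; simp

/-- The interchange of summations that turns an Eulerian series into a bilateral Lerch sum. -/
theorem tsum_div_thetaTrunc {p u : ℂ} (hp : p ≠ 0) (hp1 : ‖p‖ < 1) (hu : u ≠ 0)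
    (h : ∀ k : ℤ, u * p ^ k ≠ 1) {t : ℕ → ℂ} {C ρ : ℝ} (hρ0 : 0 ≤ ρ) (hρ : ρ < 1)
    (ht : ∀ n, ‖t n‖ ≤ C * ρ ^ n) (e : ℕ) :
    Summable (fun n => t n / (qPoch u p (n + 1) * qPoch (p / u) p (n + e))) ∧
    ∑' n, t n / (qPoch u p (n + 1) * qPoch (p / u) p (n + e))
      = ∑' r : ℤ, (-1) ^ r * p ^ tri r / (1 - u * p ^ r) *
          ∑' n : ℕ, t n * (invFact p (n - r) * invFact p (n + e + r)) := by
  obtain ⟨D, hD, hD'⟩ := exists_invFact_le hp1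
  set W : ℤ → ℂ := fun r => (-1) ^ r * p ^ tri r / (1 - u * p ^ r) with hW
  set F : ℕ × ℤ → ℂ := fun x =>
    t x.1 * (invFact p (x.1 - x.2) * invFact p (x.1 + e + x.2)) * W x.2 with hF
  have hWs : Summable fun r => ‖W r‖ := by
    simpa [hW] using summable_lerch hp hp1 hu one_ne_zero (e := 1) one_pos
  have hFs : Summable F := by
    refine Summable.of_norm_bounded ((((summable_geometric_of_lt_one hρ0 hρ).mul_left C).mul_right
      (D * D)).mul_of_nonneg hWs (fun n => ?_) fun _ => norm_nonneg _) fun x => ?_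
    · exact mul_nonneg ((norm_nonneg _).trans (ht n)) (by positivity)
    · simp only [hF, norm_mul]
      have h0 := (norm_nonneg _).trans (ht x.1)
      gcongr
      · exact ht _
      · exact hD' _
      · exact hD' _
  have h1 : ∀ n : ℕ, t n / (qPoch u p (n + 1) * qPoch (p / u) p (n + e)) = ∑' r, F (n, r) := fun n => by
    rw [div_eq_mul_inv, inv_thetaTrunc_eq_tsum hp hp1 hu h, ← tsum_mul_left]
    congr 1
    funext r
    simp only [hF, hW]
    ring
  simp only [h1]
  refine ⟨hFs.prod, ?_⟩
  rw [← hFs.tsum_prod, ← (Equiv.prodComm ℤ ℕ).tsum_eq, Summable.tsum_prod]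
  · congr 1
    funext r
    simp only [Equiv.prodComm_apply, Prod.swap, hF, hW, tsum_mul_right]
    ring
  · exact hFs.comp_injective (Equiv.prodComm ℤ ℕ).injective

/-- The reflection `r ↦ -e - r` swaps the two factorials, so the coefficients need only be computed
for `r ≥ 0`. -/
theorem tsum_invFact_symm (p : ℂ) (t : ℕ → ℂ) (e : ℕ) (r : ℤ) :
    ∑' n : ℕ, t n * (invFact p (n - (-e - r)) * invFact p (n + e + (-e - r)))
      = ∑' n : ℕ, t n * (invFact p (n - r) * invFact p (n + e + r)) := by
  congr 1
  funext n
  rw [show (n : ℤ) - (-e - r) = n + e + r by ring, show (n : ℤ) + e + (-e - r) = n - r by ring,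
    mul_comm (invFact _ _)]

/-- Terms with `n < r` vanish. Setting `n = r + k` and splitting `(p;p)_(2r+e+k)` after its first
`2r + e` factors leaves a `q`-Gauss sum whose lower parameter is `ab = p^(2r+e+1)`. -/
theorem tsum_invFact_eq {p : ℂ} (hp1 : ‖p‖ < 1) {t : ℕ → ℂ} {e r : ℕ} {τ a z b : ℂ}
    (hz : ‖z‖ < 1) (hab : a * b = p ^ (2 * r + e) * p)
    (ht : ∀ k, t (r + k) = τ * (qPoch a p k * ∏ i ∈ Finset.range k, (z - b * p ^ i))) :
    ∑' n : ℕ, t n * (invFact p (n - r) * invFact p (n + e + r))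
      = τ * (qPochInf (a * z) p * qPochInf b p) / (qPochInf p p * qPochInf z p) := by
  have hinj : Function.Injective fun k : ℕ => r + k := add_right_injective r
  rw [← hinj.tsum_eq]
  · have h1 : ∀ k : ℕ, t (r + k) * (invFact p ((r + k : ℕ) - r) * invFact p ((r + k : ℕ) + e + r))
        = τ / qPoch p p (2 * r + e) * gaussTerm a z b p k := fun k => by
      rw [show (((r + k : ℕ) : ℤ) - r) = k by push_cast; ring,
        show (((r + k : ℕ) : ℤ) + e + r) = (2 * r + e + k : ℕ) by push_cast; ring,
        invFact_natCast, invFact_natCast, ht, qPoch_add, gaussTerm, hab]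
      field_simp
    simp only [h1, tsum_mul_left]
    have h2 : ∀ i : ℕ, p ^ i * (a * b) ≠ 1 := fun i => by
      rw [hab, ← mul_assoc, ← pow_add]
      exact pow_mul_self_ne_one hp1 _
    have h3 := tsum_gaussTerm hp1 hz h2
    have h4 : qPochInf z p ≠ 0 := qPochInf_ne_zero hp1 fun i hi => by
      have := congrArg norm hi
      rw [norm_mul, norm_pow, norm_one] at this
      exact ((mul_le_of_le_one_left (norm_nonneg _) (pow_le_one₀ (norm_nonneg _) hp1.le)).trans_lt
        hz).ne this
    have h5 := qPochInf_ne_zero hp1 h2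
    have h6 := qPoch_self_ne_zero hp1 (2 * r + e)
    rw [qPochInf_eq_mul hp1 p (2 * r + e), ← hab, ← h3]
    field_simp
  · intro n hn
    refine ⟨n - r, ?_⟩
    by_contra h
    have hlt : n < r := by
      by_contra h'
      exact h (by simp only; omega)
    apply hn
    simp only
    rw [invFact, if_neg (by omega)]
    simp

/-! ### Appell–Lerch sums, theta constants and the change of `z` -/

theorem tsum_int_even_add_odd {f : ℤ → ℂ} (hf : Summable f) :
    ∑' r, f r = ∑' r, f (2 * r) + ∑' r, f (2 * r + 1) := by
  have h1 : Function.Injective fun r : ℤ => 2 * r := fun a b h => by simp only at h; omega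
  have h2 : Function.Injective fun r : ℤ => 2 * r + 1 := fun a b h => by simp only at h; omega
  have s1 := (hf.comp_injective h1).hasSum
  have s2 := (hf.comp_injective h2).hasSum
  have h3 : IsCompl (Set.range fun r : ℤ => 2 * r) (Set.range fun r : ℤ => 2 * r + 1) := by
    have e1 : (Set.range fun r : ℤ => 2 * r) = {n | Even n} := by
      ext n; simp only [Set.mem_range, Set.mem_ofPred_eq, even_iff_exists_two_mul, eq_comm]
    have e2 : (Set.range fun r : ℤ => 2 * r + 1) = {n | Odd n} := by
      ext n; simp only [Set.mem_range, Set.mem_ofPred_eq, Odd, eq_comm]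
    rw [e1, e2]
    exact Int.isCompl_even_odd
  exact ((h1.hasSum_range_iff.2 s1).add_isCompl h3 (h2.hasSum_range_iff.2 s2)).tsum_eq

theorem zpow_inj {q : ℂ} (hq : q ≠ 0) (hq1 : ‖q‖ < 1) {m n : ℤ} (h : ‖q ^ m‖ = ‖q ^ n‖) : m = n := by
  rw [norm_zpow, norm_zpow] at h
  exact zpow_right_injective₀ (norm_pos_iff.mpr hq) hq1.ne h

theorem theta_inv {u p : ℂ} (hp : p ≠ 0) (hp1 : ‖p‖ < 1) (hu : u ≠ 0) :
    theta u⁻¹ p = -u⁻¹ * theta u p := by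
  have h1 := theta_shift hp hp1 hu (-1)
  rw [neg_neg, zpow_one] at h1
  rw [← theta_div hp, div_inv_eq_mul, mul_comm p, h1, show tri (-1) = 0 from rfl, neg_zero, zpow_zero,
    zpow_neg_one, neg_inv, mul_one]

/-- Shifting `r` by one puts the exponent in the form `tri r` produced by partial fractions. -/
theorem m_eq (x q : ℂ) {z : ℂ} (hz : z ≠ 0) :
    m x q z = -(z / theta z q) * ∑' r : ℤ, (-1) ^ r * q ^ tri r * z ^ r / (1 - x * z * q ^ r) := by
  rw [m, ← (Equiv.addRight (1 : ℤ)).tsum_eq, ← tsum_mul_left, ← tsum_mul_left]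
  congr 1
  funext r
  simp only [Equiv.coe_addRight, add_sub_cancel_right]
  rw [tri, mul_comm (r + 1) r, zpow_add₀ (by norm_num), zpow_add₀ hz, zpow_one, zpow_one,
    show q ^ r * x * z = x * z * q ^ r by ring]
  ring_nf

theorem theta_neg_one (q : ℂ) (hq1 : ‖q‖ < 1) :
    theta (-1) q = 2 * qPochInf (-q) q ^ 2 * qPochInf q q := by
  have h := qPochInf_eq_mul hq1 (-1) 1
  rw [qPoch_succ, qPoch_zero, pow_zero, pow_one] at h
  rw [theta, h, div_neg, div_one, mul_neg_one]
  ring_nf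

theorem qPochInf_neg_self_ne_zero {q : ℂ} (hq1 : ‖q‖ < 1) : qPochInf (-q) q ≠ 0 :=
  left_ne_zero_of_mul_eq_one (qPochInf_neg_mul_odd hq1)

theorem qPochInf_odd_ne_zero {q : ℂ} (hq1 : ‖q‖ < 1) : qPochInf q (q ^ 2) ≠ 0 :=
  right_ne_zero_of_mul_eq_one (qPochInf_neg_mul_odd hq1)

theorem theta_neg_one_ne_zero {q : ℂ} (hq1 : ‖q‖ < 1) : theta (-1) q ≠ 0 := by
  rw [theta_neg_one q hq1]
  have h1 := qPochInf_neg_self_ne_zero hq1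
  have h2 := qPochInf_self_ne_zero hq1
  exact mul_ne_zero (mul_ne_zero two_ne_zero (pow_ne_zero 2 h1)) h2

theorem odd_div_even_eq {q : ℂ} (hq1 : ‖q‖ < 1) :
    qPochInf q (q ^ 2) / qPochInf (q ^ 2) (q ^ 2) = 2 / theta (-1) q := by
  have h1 := qPochInf_neg_mul_odd hq1
  have h2 := qPochInf_self_ne_zero hq1
  have h3 := qPochInf_neg_self_ne_zero hq1
  have h4 := qPochInf_self_ne_zero (norm_pow_lt_one hq1 two_ne_zero)
  have h5 := qPochInf_even_mul_odd hq1 q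
  rw [← pow_two] at h5
  rw [theta_neg_one q hq1, div_eq_div_iff h4 (mul_ne_zero (mul_ne_zero two_ne_zero (pow_ne_zero 2 h3)) h2)]
  linear_combination (2 * qPochInf (-q) q * qPochInf q q) * h1 + 2 * qPochInf (-q) q * h5 +
    (2 * qPochInf (q ^ 2) (q ^ 2)) * h1

theorem theta_self_sq {q : ℂ} (hq : q ≠ 0) :
    theta q (q ^ 2) = qPochInf q (q ^ 2) ^ 2 * qPochInf (q ^ 2) (q ^ 2) := by
  rw [theta, pow_two q, mul_div_cancel_right₀ _ hq]
  ring

theorem J_one_two_sq {q : ℂ} (hq : q ≠ 0) (hq1 : ‖q‖ < 1) :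
    J 1 2 q ^ 2 = 2 * qPochInf q q ^ 3 / theta (-1) q := by
  have h1 := qPochInf_neg_mul_odd hq1
  have h2 := qPochInf_self_ne_zero hq1
  have h3 := qPochInf_neg_self_ne_zero hq1
  have h5 := qPochInf_even_mul_odd hq1 q
  rw [← pow_two] at h5
  have h6 : J 1 2 q * qPochInf (-q) q = qPochInf q q := by
    rw [J, zpow_one, theta_self_sq hq, h5]
    linear_combination (qPochInf q (q ^ 2) * qPochInf (q ^ 2) (q ^ 2)) * h1
  rw [theta_neg_one q hq1, eq_div_iff (mul_ne_zero (mul_ne_zero two_ne_zero (pow_ne_zero 2 h3)) h2), ← h6]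
  ring

/-- The partial fraction expansion of the reciprocal of a theta function. -/
theorem inv_theta_eq_tsum {x q : ℂ} (hq : q ≠ 0) (hq1 : ‖q‖ < 1) (hx : x ≠ 0)
    (h : ∀ k : ℤ, x * q ^ k ≠ 1) :
    qPochInf q q ^ 3 / theta x q = ∑' r : ℤ, (-1) ^ r * q ^ tri r / (1 - x * q ^ r) := by
  have h1 := theta_partial_fractions (ι := Unit) (κ := Empty) hq hq1 (a := fun _ => 1)
    (b := fun _ => 1) (by simp) (by simp) (by simp) (by simp) hx (by simpa using h)
  simp at h1
  rw [div_eq_mul_inv, h1, mul_inv_cancel_left₀ (pow_ne_zero 3 (qPochInf_self_ne_zero hq1))]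

/-- The change of the parameter `z` in an Appell--Lerch sum. -/
theorem m_sub_m {x q z₀ z₁ : ℂ} (hq : q ≠ 0) (hq1 : ‖q‖ < 1) (hx : x ≠ 0) (h0 : z₀ ≠ 0) (h1 : z₁ ≠ 0)
    (h01 : ∀ k : ℤ, z₀ ≠ z₁ * q ^ k) (hz0 : ∀ k : ℤ, z₀ ≠ q ^ k) (hz1 : ∀ k : ℤ, z₁ ≠ q ^ k)
    (hx0 : ∀ k : ℤ, z₀ * x * q ^ k ≠ 1) (hx1 : ∀ k : ℤ, z₁ * x * q ^ k ≠ 1) :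
    m x q z₁ - m x q z₀ = z₀ * qPochInf q q ^ 3 * theta (z₁ / z₀) q * theta (z₀ * z₁ * x) q /
      (theta z₀ q * theta z₁ q * theta (z₀ * x) q * theta (z₁ * x) q) := by
  have h10 : ∀ k : ℤ, z₁ ≠ z₀ * q ^ k := fun k hk => h01 (-k) (by
    rw [hk, mul_assoc, ← zpow_add₀ hq, add_neg_cancel, zpow_zero, mul_one])
  -- The numerator `j(z₀z₁x)` is chosen so that the two pole families of the quotient by `j(z₀x)
  -- j(z₁x)` carry exactly the powers `z₀^r` and `z₁^r` of the two Lerch series.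
  have key := theta_partial_fractions (ι := Fin 2) (κ := Unit) hq hq1 (a := ![z₀, z₁])
    (b := fun _ => z₀ * z₁) (by intro i; fin_cases i <;> simpa) (by simp [h0, h1]) (by simp)
    (by intro i j hij k; fin_cases i <;> fin_cases j <;> simp at hij ⊢ <;> first | exact h01 k | exact h10 k)
    hx (by intro i k; fin_cases i <;> simp <;> first | exact hx0 k | exact hx1 k)
  have e0 : (Finset.univ.erase (0 : Fin 2)) = {1} := by decide
  have e1 : (Finset.univ.erase (1 : Fin 2)) = {0} := by decide
  simp only [Fin.sum_univ_two, Fin.prod_univ_two, e0, e1, Finset.prod_singleton, Finset.univ_unique,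
    Matrix.cons_val_zero, Matrix.cons_val_one, Fintype.card_fin, Fintype.card_unit] at key
  have r0 : -(z₀ * z₁ / z₀) / -(z₁ / z₀) = z₀ := by field_simp
  have r1 : -(z₀ * z₁ / z₁) / -(z₀ / z₁) = z₁ := by field_simp
  rw [r0, r1, mul_div_cancel_left₀ _ h0, mul_div_cancel_right₀ _ h1] at key
  norm_num at key
  have t : theta (z₀ / z₁) q = -(z₀ / z₁) * theta (z₁ / z₀) q := by
    have := theta_inv hq hq1 (div_ne_zero h1 h0)
    rwa [inv_div] at this
  rw [t] at key
  have n0 := theta_ne_zero h0 hq hq1 hz0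
  have n1 := theta_ne_zero h1 hq hq1 hz1
  have n2 : theta (z₁ / z₀) q ≠ 0 := theta_ne_zero (div_ne_zero h1 h0) hq hq1 fun k hk =>
    h10 k (by rw [← hk, mul_div_cancel₀ _ h0])
  have n3 := qPochInf_self_ne_zero hq1
  rw [m_eq x q h0, m_eq x q h1]
  simp only [mul_comm x]
  have h2 : z₀ * qPochInf q q ^ 3 * theta (z₁ / z₀) q * theta (z₀ * z₁ * x) q /
      (theta z₀ q * theta z₁ q * theta (z₀ * x) q * theta (z₁ * x) q)
      = z₀ * qPochInf q q ^ 3 * theta (z₁ / z₀) q / (theta z₀ q * theta z₁ q) *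
        (theta (z₀ * z₁ * x) q / (theta (z₀ * x) q * theta (z₁ * x) q)) := by
    rw [div_mul_div_comm, mul_assoc (theta z₀ q * theta z₁ q)]
  rw [h2, key]
  generalize ∑' r : ℤ, (-1) ^ r * q ^ tri r * z₀ ^ r / (1 - z₀ * x * q ^ r) = S0
  generalize ∑' r : ℤ, (-1) ^ r * q ^ tri r * z₁ ^ r / (1 - z₁ * x * q ^ r) = S1
  field_simp
  ring

/-! ### Evaluating the series of `term₁`, `term₂` and `term₄` -/

/-- With `y = s q^(2r+1)`, one has `(1 + 1/x) / ((1 + y)(1 - xy)) = 1/(1 - xy) + (1/x)/(1 + y)`. The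
symmetry of `h` makes the last part odd under `r ↦ -1 - r`, so it sums to zero. The sign `s` is `1`
for `term₁` and `-1` for `term₄`. -/
theorem tsum_split {x q s : ℂ} (hx : x ≠ 0) (hs : s * s = 1) {h : ℤ → ℂ} (hq : q ≠ 0)
    (hsymm : ∀ r, h (-1 - r) * q ^ (2 * r + 1) = -s * h r)
    (S1 : Summable fun r => h r / (1 - s * x * q ^ (2 * r + 1)))
    (S2 : Summable fun r => h r / (1 + s * q ^ (2 * r + 1)))
    (n1 : ∀ r : ℤ, 1 - s * x * q ^ (2 * r + 1) ≠ 0) (n2 : ∀ r : ℤ, 1 + s * q ^ (2 * r + 1) ≠ 0) :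
    ∑' r : ℤ, (1 + 1 / x) * (h r / ((1 + s * q ^ (2 * r + 1)) * (1 - s * x * q ^ (2 * r + 1))))
      = ∑' r : ℤ, h r / (1 - s * x * q ^ (2 * r + 1)) := by
  have h1 : ∀ r : ℤ, (1 + 1 / x) * (h r / ((1 + s * q ^ (2 * r + 1)) * (1 - s * x * q ^ (2 * r + 1))))
      = h r / (1 - s * x * q ^ (2 * r + 1)) + 1 / x * (h r / (1 + s * q ^ (2 * r + 1))) := fun r => by
    have h1 := n1 r
    have h2 := n2 r
    generalize q ^ (2 * r + 1) = y at h1 h2 ⊢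
    have h3 : 1 - x * s * y ≠ 0 := by rwa [mul_comm x]
    field_simp
    ring
  simp only [h1]
  rw [S1.tsum_add (S2.mul_left _), tsum_mul_left]
  have h2 : ∑' r : ℤ, h r / (1 + s * q ^ (2 * r + 1)) = 0 := by
    have h3 := (Equiv.subLeft (-1 : ℤ)).tsum_eq fun r : ℤ => h r / (1 + s * q ^ (2 * r + 1))
    have h4 : ∀ r : ℤ, h (Equiv.subLeft (-1) r) / (1 + s * q ^ (2 * (Equiv.subLeft (-1) r) + 1))
        = -(h r / (1 + s * q ^ (2 * r + 1))) := fun r => by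
      have n3 := n2 (-1 - r)
      have n4 := n2 r
      have h5 := hsymm r
      have h6 : q ^ (2 * r + 1) ≠ 0 := zpow_ne_zero _ hq
      simp only [Equiv.subLeft_apply]
      rw [show 2 * (-1 - r) + 1 = -(2 * r + 1) by ring, zpow_neg] at n3 ⊢
      rw [← neg_div, div_eq_div_iff n3 n4]
      field_simp
      linear_combination (1 + s * q ^ (2 * r + 1)) * h5 - h r * (q ^ (2 * r + 1)) * hs
    simp only [h4, tsum_neg] at h3
    exact self_eq_neg.mp h3.symm
  rw [h2, mul_zero, add_zero]

theorem sq_zpow (q : ℂ) (k : ℤ) : (q ^ 2) ^ k = q ^ (2 * k) := by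
  rw [← zpow_natCast, ← zpow_mul]; rfl

theorem qPochInf_zero (q : ℂ) : qPochInf 0 q = 1 := by simp [qPochInf]

theorem qPoch_even_mul_odd (x q : ℂ) (n : ℕ) :
    qPoch x q (2 * n) = qPoch x (q ^ 2) n * qPoch (q * x) (q ^ 2) n := by
  induction n with
  | zero => simp [qPoch_zero]
  | succ n ih =>
    rw [show 2 * (n + 1) = 2 * n + 1 + 1 by ring, qPoch_succ, qPoch_succ, qPoch_succ, qPoch_succ, ih]
    ring

theorem neg_one_zpow_mul_self (r : ℤ) : (-1 : ℂ) ^ r * (-1) ^ r = 1 := by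
  rw [← mul_zpow]; simp

theorem neg_one_zpow_neg (r : ℤ) : (-1 : ℂ) ^ (-r) = (-1) ^ r := by
  rw [zpow_neg, ← inv_zpow]; norm_num

theorem neg_mul_sq_zpow_ne_one {q x : ℂ} (h : ∀ k : ℤ, x ≠ -q ^ (2 * k)) (k : ℤ) :
    -x * (q ^ 2) ^ k ≠ 1 := fun h1 => h (-k) (by
  rw [mul_neg, zpow_neg, ← sq_zpow, ← eq_inv_of_mul_eq_one_left h1, neg_neg])

theorem one_add_mul_zpow_odd_ne_zero {q : ℂ} (hq : q ≠ 0) (hq1 : ‖q‖ < 1) {s : ℂ} (hs : ‖s‖ = 1) (r : ℤ) :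
    1 + s * q ^ (2 * r + 1) ≠ 0 := fun h => by
  have h1 : s * q ^ (2 * r + 1) = -1 := by linear_combination h
  have h2 := congrArg norm h1
  rw [norm_mul, hs, one_mul, norm_neg, norm_one] at h2
  have h3 := zpow_inj hq hq1 (m := 2 * r + 1) (n := 0) (by rw [h2]; simp)
  omega

/-- The series over the even indices in `m(x,q,-1)`. -/
noncomputable def evenLerch (x q : ℂ) : ℂ := ∑' r : ℤ, q ^ (2 * r ^ 2 + r) / (1 + x * q ^ (2 * r))

/-- The series over the odd indices in `m(x,q,-1)`. -/
noncomputable def oddLerch (x q : ℂ) : ℂ :=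
  ∑' r : ℤ, q ^ ((2 * r + 1) * (r + 1)) / (1 + x * q ^ (2 * r + 1))

theorem neg_one_pow_mul_pow_sq_add {q : ℂ} (r k : ℕ) :
    (-1 : ℂ) ^ (r + k) * q ^ ((r + k) ^ 2)
      = (-1) ^ r * q ^ (r ^ 2) * ∏ i ∈ Finset.range k, (0 - q ^ (2 * r + 1) * (q ^ 2) ^ i) := by
  induction k with
  | zero => simp
  | succ k ih =>
    rw [Finset.prod_range_succ, ← mul_assoc, ← ih, ← add_assoc]
    ring

theorem exists_neg_one_pow_mul_le {q : ℂ} (hq1 : ‖q‖ < 1) {f : ℕ → ℕ} (hf : ∀ n, n ≤ f n) :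
    ∃ C : ℝ, ∀ n, ‖(-1) ^ n * q ^ (f n) * qPoch q (q ^ 2) n‖ ≤ C * ‖q‖ ^ n := by
  obtain ⟨C, hC, hC'⟩ := exists_qPoch_le (norm_pow_lt_one hq1 two_ne_zero) q
  refine ⟨C, fun n => ?_⟩
  rw [norm_mul, norm_mul, norm_pow, norm_neg, norm_one, one_pow, one_mul, norm_pow, mul_comm]
  exact mul_le_mul (hC' n) (pow_le_pow_of_le_one (norm_nonneg _) hq1.le (hf n)) (by positivity) hC.le

theorem qPoch_odd_mul_qPochInf {q : ℂ} (hq1 : ‖q‖ < 1) (r : ℕ) :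
    qPoch q (q ^ 2) r * qPochInf (q ^ (2 * r + 1)) (q ^ 2) = qPochInf q (q ^ 2) := by
  rw [qPochInf_eq_mul (norm_pow_lt_one hq1 two_ne_zero) q r, pow_succ q (2 * r), pow_mul]

theorem qPoch_odd_add (q : ℂ) (r k : ℕ) :
    qPoch q (q ^ 2) (r + k) = qPoch q (q ^ 2) r * qPoch (q ^ (2 * r + 1)) (q ^ 2) k := by
  rw [qPoch_add, pow_succ q (2 * r), pow_mul]

/-- Confluent `q`-Gauss, `z = 0` and `a = b = q^(2r+1)`: the square exponent comes from the product
of the `-b q^(2i)`, and the factors in `r` recombine to `(q;q²)_∞`. -/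
theorem term₂_coeff {q : ℂ} (hq1 : ‖q‖ < 1) (r : ℤ) :
    ∑' n : ℕ, (-1) ^ n * q ^ (n ^ 2) * qPoch q (q ^ 2) n *
        (invFact (q ^ 2) (n - r) * invFact (q ^ 2) (n + (0 : ℕ) + r))
      = (-1) ^ r * q ^ (r ^ 2) * (2 / theta (-1) q) := by
  have hp1 := norm_pow_lt_one hq1 two_ne_zero
  have key : ∀ r : ℕ, ∑' n : ℕ, (-1) ^ n * q ^ (n ^ 2) * qPoch q (q ^ 2) n *
        (invFact (q ^ 2) (n - r) * invFact (q ^ 2) (n + (0 : ℕ) + r))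
      = (-1) ^ r * q ^ (r ^ 2) * (2 / theta (-1) q) := fun r => by
    rw [tsum_invFact_eq hp1 (t := fun n => (-1) ^ n * q ^ (n ^ 2) * qPoch q (q ^ 2) n) (e := 0) (r := r)
      (τ := (-1) ^ r * q ^ (r ^ 2) * qPoch q (q ^ 2) r) (a := q ^ (2 * r + 1)) (z := 0)
      (b := q ^ (2 * r + 1)) (by simp) (by ring), mul_zero, qPochInf_zero, ← odd_div_even_eq hq1,
      ← qPoch_odd_mul_qPochInf hq1 r]
    · ring
    · intro k
      rw [neg_one_pow_mul_pow_sq_add, qPoch_odd_add]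
      ring
  obtain ⟨n, rfl | rfl⟩ := r.eq_nat_or_neg
  · rw [key n]; norm_cast
  · have h := tsum_invFact_symm (q ^ 2) (fun n => (-1) ^ n * q ^ (n ^ 2) * qPoch q (q ^ 2) n) 0 n
    rw [Nat.cast_zero, neg_zero, zero_sub] at h
    rw [Nat.cast_zero, h]
    have := key n
    rw [Nat.cast_zero] at this
    rw [this, neg_one_zpow_neg, neg_sq]
    norm_cast

theorem term₂_hasSum {q x : ℂ} (hq : q ≠ 0) (hq1 : ‖q‖ < 1) (hx : x ≠ 0)
    (h : ∀ k : ℤ, x ≠ -q ^ (2 * k)) :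
    Summable (term₂ x q) ∧ ∑' n, term₂ x q n = 2 / theta (-1) q * evenLerch x q := by
  have hp1 := norm_pow_lt_one hq1 two_ne_zero
  obtain ⟨C, hC⟩ := exists_neg_one_pow_mul_le hq1 (f := fun n => n ^ 2)
    fun n => Nat.le_self_pow two_ne_zero n
  have h1 := tsum_div_thetaTrunc (pow_ne_zero 2 hq) hp1 (neg_ne_zero.mpr hx)
    (neg_mul_sq_zpow_ne_one h) (norm_nonneg q) hq1 hC 0
  have h2 : term₂ x q = fun n => (-1) ^ n * q ^ (n ^ 2) * qPoch q (q ^ 2) n /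
      (qPoch (-x) (q ^ 2) (n + 1) * qPoch (q ^ 2 / -x) (q ^ 2) (n + 0)) := by
    funext n
    rw [term₂, div_neg, neg_div, add_zero]
  rw [h2]
  refine ⟨h1.1, h1.2.trans ?_⟩
  rw [evenLerch, ← tsum_mul_left]
  congr 1
  funext r
  rw [term₂_coeff hq1, sq_zpow, sq_zpow, two_mul_tri, show 2 * r ^ 2 + r = r * (r + 1) + r ^ 2 by ring,
    zpow_add₀ hq, neg_mul, sub_neg_eq_add]
  linear_combination (q ^ (r * (r + 1)) / (1 + x * q ^ (2 * r)) * q ^ (r ^ 2) * (2 / theta (-1) q)) *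
    neg_one_zpow_mul_self r

/-- Again `z = 0`, now with `b = q^(2r+3)`. The factor `1 - q^(2r+1)` falls in the gap between
`(q;q²)_r` and `(b;q²)_∞`, which puts it in the denominator. -/
theorem term₄_coeff {q : ℂ} (hq : q ≠ 0) (hq1 : ‖q‖ < 1) (r : ℤ) :
    ∑' n : ℕ, (-1) ^ n * q ^ ((n + 1) ^ 2) * qPoch q (q ^ 2) n *
        (invFact (q ^ 2) (n - r) * invFact (q ^ 2) (n + (1 : ℕ) + r))
      = (-1) ^ r * q ^ ((r + 1) ^ 2) * (2 / theta (-1) q) / (1 - q ^ (2 * r + 1)) := by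
  have hp1 := norm_pow_lt_one hq1 two_ne_zero
  have hne : ∀ r : ℤ, 1 - q ^ (2 * r + 1) ≠ 0 := fun r => by
    have := one_add_mul_zpow_odd_ne_zero hq hq1 (s := -1) (by simp) r
    rwa [neg_one_mul, ← sub_eq_add_neg] at this
  have key : ∀ r : ℕ, ∑' n : ℕ, (-1) ^ n * q ^ ((n + 1) ^ 2) * qPoch q (q ^ 2) n *
        (invFact (q ^ 2) (n - r) * invFact (q ^ 2) (n + (1 : ℕ) + r))
      = (-1) ^ r * q ^ ((r + 1) ^ 2) * (2 / theta (-1) q) / (1 - q ^ (2 * r + 1)) := fun r => by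
    have h0 : 1 - q ^ (2 * r + 1) ≠ 0 := by exact_mod_cast hne r
    rw [tsum_invFact_eq hp1 (t := fun n => (-1) ^ n * q ^ ((n + 1) ^ 2) * qPoch q (q ^ 2) n) (e := 1)
      (r := r) (τ := (-1) ^ r * q ^ ((r + 1) ^ 2) * qPoch q (q ^ 2) r) (a := q ^ (2 * r + 1)) (z := 0)
      (b := q ^ (2 * (r + 1) + 1)) (by simp) (by ring), mul_zero, qPochInf_zero, ← odd_div_even_eq hq1,
      ← qPoch_odd_mul_qPochInf hq1 (r + 1), qPoch_succ, ← pow_mul, ← pow_succ]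
    · rw [one_mul, mul_one]
      field_simp
    · intro k
      have := neg_one_pow_mul_pow_sq_add (q := q) (r + 1) k
      rw [show r + 1 + k = r + k + 1 by ring, pow_succ, pow_succ (-1 : ℂ) r] at this
      rw [qPoch_odd_add]
      linear_combination (-qPoch q (q ^ 2) r * qPoch (q ^ (2 * r + 1)) (q ^ 2) k) * this
  rcases le_or_gt 0 r with hr | hr
  · obtain ⟨n, rfl⟩ := Int.eq_ofNat_of_zero_le hr
    rw [key n]; norm_cast
  · obtain ⟨n, hn⟩ := Int.eq_ofNat_of_zero_le (show 0 ≤ -1 - r by omega)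
    obtain rfl : r = -1 - n := by omega
    have h := tsum_invFact_symm (q ^ 2) (fun n => (-1) ^ n * q ^ ((n + 1) ^ 2) * qPoch q (q ^ 2) n) 1 n
    rw [Nat.cast_one] at h
    rw [Nat.cast_one, h]
    have := key n
    rw [Nat.cast_one] at this
    rw [this]
    have h1 := hne n
    have h2 := hne (-1 - n)
    rw [show 2 * (-1 - (n : ℤ)) + 1 = -(2 * n + 1) by ring, zpow_neg] at h2 ⊢
    have h3 : q ^ (2 * (n : ℤ) + 1) ≠ 0 := zpow_ne_zero _ hq
    have h4 : (-1 : ℂ) ^ (-1 - n : ℤ) = -(-1) ^ n := by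
      rw [zpow_sub₀ (by norm_num), zpow_neg_one, zpow_natCast]
      have : ((-1 : ℂ) ^ n) * (-1) ^ n = 1 := by rw [← mul_pow]; simp
      have h5 : (-1 : ℂ) ^ n ≠ 0 := by simp
      field_simp
      linear_combination this
    have h5 : q ^ ((n + 1) ^ 2) = q ^ ((-1 - (n : ℤ) + 1) ^ 2) * q ^ (2 * (n : ℤ) + 1) := by
      rw [← zpow_natCast, ← zpow_add₀ hq]
      congr 1
      push_cast
      ring
    have h6 : q ^ (2 * n + 1) = q ^ (2 * (n : ℤ) + 1) := by norm_cast
    rw [h4, h5, h6]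
    generalize q ^ (2 * (n : ℤ) + 1) = y at *
    rw [div_eq_div_iff h1 h2]
    field_simp
    ring

theorem term₄_hasSum {q x : ℂ} (hq : q ≠ 0) (hq1 : ‖q‖ < 1) (hx : x ≠ 0)
    (h : ∀ k : ℤ, x ≠ -q ^ (2 * k + 1)) :
    Summable (term₄ x q) ∧ (1 + 1 / x) * ∑' n, term₄ x q n = 2 / theta (-1) q * oddLerch x q := by
  have hp1 := norm_pow_lt_one hq1 two_ne_zero
  have hp0 := pow_ne_zero 2 hq
  obtain ⟨C, hC⟩ := exists_neg_one_pow_mul_le hq1 (f := fun n => (n + 1) ^ 2)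
    fun n => (Nat.le_succ n).trans (Nat.le_self_pow two_ne_zero _)
  have hu : ∀ k : ℤ, -x * q * (q ^ 2) ^ k ≠ 1 := fun k h1 => h (-(k + 1)) (by
    rw [sq_zpow, mul_assoc, ← zpow_one_add₀ hq] at h1
    rw [show 2 * -(k + 1) + 1 = -(1 + 2 * k) by ring, zpow_neg, ← eq_inv_of_mul_eq_one_left h1, neg_neg])
  have h1 := tsum_div_thetaTrunc hp0 hp1 (mul_ne_zero (neg_ne_zero.mpr hx) hq) hu (norm_nonneg q) hq1 hC 1
  have h2 : term₄ x q = fun n => (-1) ^ n * q ^ ((n + 1) ^ 2) * qPoch q (q ^ 2) n /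
      (qPoch (-x * q) (q ^ 2) (n + 1) * qPoch (q ^ 2 / (-x * q)) (q ^ 2) (n + 1)) := by
    funext n
    rw [term₄, show q ^ 2 / (-x * q) = -q / x by field_simp]
    ring
  have n1 : ∀ r : ℤ, 1 - -1 * x * q ^ (2 * r + 1) ≠ 0 := fun r h3 => hu r (by
    rw [sq_zpow, mul_assoc, ← zpow_one_add₀ hq, add_comm 1]
    linear_combination -h3)
  have e1 : ∀ r : ℤ, q ^ ((2 * r + 1) * (r + 1)) = q * ((-1) ^ r * (q ^ 2) ^ (tri r * 2) * (-q) ^ r) := fun r => by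
    rw [sq_zpow, show -q = -1 * q by ring, mul_zpow, show (2 * r + 1) * (r + 1) = 1 + 2 * (tri r * 2) + r by
      linear_combination -2 * two_mul_tri r, zpow_add₀ hq, zpow_add₀ hq, zpow_one]
    linear_combination (-q * q ^ (2 * (tri r * 2)) * q ^ r) * neg_one_zpow_mul_self r
  have e2 : ∀ r : ℤ, q ^ (2 * r + 1) = q * (q ^ 2) ^ r := fun r => by
    rw [sq_zpow, add_comm, zpow_one_add₀ hq]
  rw [h2]
  refine ⟨h1.1, ?_⟩
  rw [h1.2]
  have h3 := tsum_split (x := x) (q := q) (s := -1) hx (by norm_num)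
    (h := fun r => q ^ ((2 * r + 1) * (r + 1))) hq (fun r => ?_) ?_ ?_ n1
    (one_add_mul_zpow_odd_ne_zero hq hq1 (by simp))
  · have h4 : oddLerch x q = ∑' r : ℤ, q ^ ((2 * r + 1) * (r + 1)) / (1 - -1 * x * q ^ (2 * r + 1)) := by
      rw [oddLerch]
      congr 1
      funext r
      congr 1
      ring
    rw [h4, ← h3, ← tsum_mul_left, ← tsum_mul_left]
    congr 1
    funext r
    rw [term₄_coeff hq hq1, show 1 - -x * q * (q ^ 2) ^ r = 1 - -1 * x * q ^ (2 * r + 1) by rw [e2]; ring,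
      sq_zpow, two_mul_tri, show (2 * r + 1) * (r + 1) = r * (r + 1) + (r + 1) ^ 2 by ring,
      zpow_add₀ hq (r * (r + 1)), show 1 - q ^ (2 * r + 1) = 1 + -1 * q ^ (2 * r + 1) by ring]
    have n2 := one_add_mul_zpow_odd_ne_zero hq hq1 (s := -1) (by simp) r
    have n3 := n1 r
    generalize 1 + -1 * q ^ (2 * r + 1) = A at n2 ⊢
    generalize 1 - -1 * x * q ^ (2 * r + 1) = B at n3 ⊢
    linear_combination ((1 + 1 / x) * q ^ (r * (r + 1)) * q ^ ((r + 1) ^ 2) / B / A *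
      (2 / theta (-1) q)) * neg_one_zpow_mul_self r
  · rw [← zpow_add₀ hq, neg_neg, one_mul]
    congr 1
    ring
  · simp only [e1, e2]
    refine ((summable_lerch hp0 hp1 (mul_ne_zero (neg_ne_zero.mpr hx) hq) (neg_ne_zero.mpr hq)
      (e := 2) two_pos).of_norm.mul_left q).congr fun r => ?_
    rw [mul_div_assoc']
    congr 1
    ring
  · simp only [e1, e2]
    refine ((summable_lerch hp0 hp1 hq (neg_ne_zero.mpr hq)
      (e := 2) two_pos).of_norm.mul_left q).congr fun r => ?_
    rw [mul_div_assoc']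
    congr 1
    ring

theorem qPochInf_pow_even_tail {q : ℂ} (hq1 : ‖q‖ < 1) (r : ℕ) :
    qPoch (-q) q (2 * r) * (1 + q ^ (2 * r + 1)) * qPochInf (-q ^ (2 * r + 2)) q = qPochInf (-q) q := by
  rw [qPochInf_eq_mul hq1 (-q) (2 * r + 1), qPoch_succ,
    show q ^ (2 * r + 1) * -q = -q ^ (2 * r + 2) by ring]
  ring

/-- Splitting `(-q;q)_(2n)` into even and odd factors fits `q`-Gauss with `z = q`. Its two numerator
products merge into `(-q^(2r+2);q)_∞`, and Euler's identity turns `(-q;q)_∞` into `1 / (q;q²)_∞`. -/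
theorem term₁_coeff {q : ℂ} (hq : q ≠ 0) (hq1 : ‖q‖ < 1) (r : ℤ) :
    ∑' n : ℕ, q ^ (n + 1) * qPoch (-q) q (2 * n) *
        (invFact (q ^ 2) (n - r) * invFact (q ^ 2) (n + (1 : ℕ) + r))
      = q ^ (r + 1) / (1 + q ^ (2 * r + 1)) / theta q (q ^ 2) := by
  have hp1 := norm_pow_lt_one hq1 two_ne_zero
  have hne : ∀ r : ℤ, 1 + q ^ (2 * r + 1) ≠ 0 := fun r => by
    have := one_add_mul_zpow_odd_ne_zero hq hq1 (s := 1) (by simp) r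
    rwa [one_mul] at this
  have key : ∀ r : ℕ, ∑' n : ℕ, q ^ (n + 1) * qPoch (-q) q (2 * n) *
        (invFact (q ^ 2) (n - r) * invFact (q ^ 2) (n + (1 : ℕ) + r))
      = q ^ (r + 1) / (1 + q ^ (2 * r + 1)) / theta q (q ^ 2) := fun r => by
    have h0 : 1 + q ^ (2 * r + 1) ≠ 0 := by exact_mod_cast hne r
    rw [tsum_invFact_eq hp1 (t := fun n => q ^ (n + 1) * qPoch (-q) q (2 * n)) (e := 1)
      (r := r) (τ := q ^ (r + 1) * qPoch (-q) q (2 * r)) (a := -q ^ (2 * r + 1)) (z := q)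
      (b := -q ^ (2 * r + 3)) hq1 (by ring)]
    · have h1 := qPochInf_pow_even_tail hq1 r
      have h2 := qPochInf_even_mul_odd hq1 (-q ^ (2 * r + 2))
      rw [show q * -q ^ (2 * r + 2) = -q ^ (2 * r + 3) by ring] at h2
      have h3 := qPochInf_neg_mul_odd hq1
      have h4 := qPochInf_odd_ne_zero hq1
      have h5 := qPochInf_self_ne_zero hp1
      rw [show -q ^ (2 * r + 1) * q = -q ^ (2 * r + 2) by ring, ← h2, theta_self_sq hq]
      field_simp
      linear_combination qPochInf q (q ^ 2) * h1 + h3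
    · intro k
      have h6 : ∏ i ∈ Finset.range k, (q - -q ^ (2 * r + 3) * (q ^ 2) ^ i)
          = q ^ k * qPoch (-q ^ (2 * r + 2)) (q ^ 2) k := by
        have h7 : q ^ k = ∏ _i ∈ Finset.range k, q := by simp
        rw [qPoch, h7, ← Finset.prod_mul_distrib]
        exact Finset.prod_congr rfl fun i _ => by ring
      rw [h6, qPoch_even_mul_odd, qPoch_even_mul_odd, qPoch_add, qPoch_add,
        show (q ^ 2) ^ r * -q = -q ^ (2 * r + 1) by ring,
        show (q ^ 2) ^ r * (q * -q) = -q ^ (2 * r + 2) by ring]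
      ring
  rcases le_or_gt 0 r with hr | hr
  · obtain ⟨n, rfl⟩ := Int.eq_ofNat_of_zero_le hr
    rw [key n]; norm_cast
  · obtain ⟨n, hn⟩ := Int.eq_ofNat_of_zero_le (show 0 ≤ -1 - r by omega)
    obtain rfl : r = -1 - n := by omega
    have h := tsum_invFact_symm (q ^ 2) (fun n => q ^ (n + 1) * qPoch (-q) q (2 * n)) 1 n
    rw [Nat.cast_one] at h
    rw [Nat.cast_one, h]
    have := key n
    rw [Nat.cast_one] at this
    rw [this]
    congr 1
    have h1 := hne n
    have h2 := hne (-1 - n)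
    have h6 : q ^ (2 * n + 1) = q ^ (2 * (n : ℤ) + 1) := by norm_cast
    have h7 : q ^ (n + 1) = q ^ (-1 - (n : ℤ) + 1) * q ^ (2 * (n : ℤ) + 1) := by
      rw [← zpow_natCast, ← zpow_add₀ hq]
      congr 1
      push_cast
      ring
    rw [show 2 * (-1 - (n : ℤ)) + 1 = -(2 * n + 1) by ring, zpow_neg] at h2 ⊢
    have h3 : q ^ (2 * (n : ℤ) + 1) ≠ 0 := zpow_ne_zero _ hq
    rw [h6, h7]
    generalize q ^ (2 * (n : ℤ) + 1) = y at *
    rw [div_eq_div_iff h1 h2]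
    field_simp
    ring

theorem term₁_hasSum {q x : ℂ} (hq : q ≠ 0) (hq1 : ‖q‖ < 1) (hx : x ≠ 0)
    (h : ∀ k : ℤ, x ≠ q ^ (2 * k + 1)) :
    Summable (term₁ x q) ∧ (1 + x⁻¹) * ∑' n, term₁ x q n = -m x (q ^ 2) q := by
  have hp1 := norm_pow_lt_one hq1 two_ne_zero
  have hp0 := pow_ne_zero 2 hq
  obtain ⟨C, hC⟩ : ∃ C : ℝ, ∀ n : ℕ, ‖q ^ (n + 1) * qPoch (-q) q (2 * n)‖ ≤ C * ‖q‖ ^ n := by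
    obtain ⟨C, hC, hC'⟩ := exists_qPoch_le hq1 (-q)
    refine ⟨C, fun n => ?_⟩
    rw [norm_mul, norm_pow, mul_comm]
    exact mul_le_mul (hC' _) (pow_le_pow_of_le_one (norm_nonneg _) hq1.le n.le_succ) (by positivity) hC.le
  have e2 : ∀ r : ℤ, q ^ (2 * r + 1) = q * (q ^ 2) ^ r := fun r => by
    rw [sq_zpow, add_comm, zpow_one_add₀ hq]
  have hu : ∀ k : ℤ, q * x * (q ^ 2) ^ k ≠ 1 := fun k h1 => h (-(k + 1)) (by
    rw [show 2 * -(k + 1) + 1 = -(2 * k + 1) by ring, zpow_neg, e2]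
    exact eq_inv_of_mul_eq_one_left (by linear_combination h1))
  have h1 := tsum_div_thetaTrunc hp0 hp1 (mul_ne_zero hq hx) hu (norm_nonneg q) hq1 hC 1
  have h2 : term₁ x q = fun n => q ^ (n + 1) * qPoch (-q) q (2 * n) /
      (qPoch (q * x) (q ^ 2) (n + 1) * qPoch (q ^ 2 / (q * x)) (q ^ 2) (n + 1)) := by
    funext n
    rw [term₁, show q ^ 2 / (q * x) = q / x by field_simp]
  have n1 : ∀ r : ℤ, 1 - 1 * x * q ^ (2 * r + 1) ≠ 0 := fun r h3 => hu r (by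
    rw [e2] at h3
    linear_combination -h3)
  have e1 : ∀ r : ℤ, (-1) ^ r * q ^ ((r + 1) ^ 2) = q * ((-1) ^ r * (q ^ 2) ^ (tri r * 1) * q ^ r) := fun r => by
    rw [sq_zpow, show (r + 1) ^ 2 = 1 + 2 * (tri r * 1) + r by linear_combination -two_mul_tri r,
      zpow_add₀ hq, zpow_add₀ hq, zpow_one]
    ring
  rw [h2]
  refine ⟨h1.1, ?_⟩
  rw [h1.2]
  have h3 := tsum_split (x := x) (q := q) (s := 1) hx (by norm_num)
    (h := fun r => (-1) ^ r * q ^ ((r + 1) ^ 2)) hq (fun r => ?_) ?_ ?_ n1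
    (one_add_mul_zpow_odd_ne_zero hq hq1 (by simp))
  · have h4 : -m x (q ^ 2) q = (theta q (q ^ 2))⁻¹ *
        ∑' r : ℤ, (-1) ^ r * q ^ ((r + 1) ^ 2) / (1 - 1 * x * q ^ (2 * r + 1)) := by
      rw [m_eq _ _ hq, ← tsum_mul_left, ← tsum_mul_left, ← tsum_neg]
      congr 1
      funext r
      rw [e1, e2, one_mul, mul_one, mul_assoc x q]
      ring
    rw [h4, ← h3, ← tsum_mul_left, ← tsum_mul_left]
    congr 1
    funext r
    rw [term₁_coeff hq hq1, show 1 - q * x * (q ^ 2) ^ r = 1 - 1 * x * q ^ (2 * r + 1) by rw [e2]; ring,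
      sq_zpow, two_mul_tri, show (r + 1) ^ 2 = r * (r + 1) + (r + 1) by ring,
      zpow_add₀ hq (r * (r + 1)), show 1 + q ^ (2 * r + 1) = 1 + 1 * q ^ (2 * r + 1) by ring]
    generalize 1 + 1 * q ^ (2 * r + 1) = A
    generalize 1 - 1 * x * q ^ (2 * r + 1) = B
    ring
  · rw [mul_assoc, ← zpow_add₀ hq, zpow_sub₀ (by norm_num), zpow_neg_one,
      show (-1 - r + 1) ^ 2 + (2 * r + 1) = (r + 1) ^ 2 by ring]
    have h5 : ((-1 : ℂ) ^ r)⁻¹ = (-1) ^ r := by rw [← zpow_neg, neg_one_zpow_neg]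
    rw [div_eq_mul_inv, h5]
    ring
  · simp only [e1, e2]
    refine ((summable_lerch hp0 hp1 (mul_ne_zero hx hq) hq (e := 1) one_pos).of_norm.mul_left q).congr
      fun r => ?_
    rw [mul_div_assoc']
    congr 1
    ring
  · simp only [e1, e2]
    refine ((summable_lerch hp0 hp1 (neg_ne_zero.mpr hq) hq
      (e := 1) one_pos).of_norm.mul_left q).congr fun r => ?_
    rw [mul_div_assoc']
    congr 1
    ring

/-! ### The Lerch series of `m x q (-1)` and its two halves -/

theorem tri_two_mul (r : ℤ) : tri (2 * r) = 2 * r ^ 2 + r := by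
  have := two_mul_tri (2 * r)
  linarith

theorem tri_two_mul_add_one (r : ℤ) : tri (2 * r + 1) = (2 * r + 1) * (r + 1) := by
  have := two_mul_tri (2 * r + 1)
  linarith

theorem neg_one_zpow_two_mul (r : ℤ) : (-1 : ℂ) ^ (2 * r) = 1 := by
  rw [zpow_mul]; simp

theorem neg_one_zpow_two_mul_add_one (r : ℤ) : (-1 : ℂ) ^ (2 * r + 1) = -1 := by
  rw [zpow_add₀ (by norm_num), neg_one_zpow_two_mul]; simp

theorem m_neg_one_eq_tsum (x q : ℂ) :
    m x q (-1) = (theta (-1) q)⁻¹ * ∑' r : ℤ, q ^ tri r / (1 + x * q ^ r) := by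
  rw [m_eq x q (by norm_num), neg_div, neg_neg, one_div]
  congr 2
  funext r
  rw [mul_right_comm, neg_one_zpow_mul_self]
  ring

theorem summable_neg_one_lerch {x q : ℂ} (hq : q ≠ 0) (hq1 : ‖q‖ < 1) (hx : x ≠ 0) :
    Summable fun r : ℤ => q ^ tri r / (1 + x * q ^ r) := by
  refine (summable_lerch hq hq1 (neg_ne_zero.mpr hx) (w := -1) (by norm_num) (e := 1)
    one_pos).of_norm.congr fun r => ?_
  rw [mul_right_comm, neg_one_zpow_mul_self]
  ring_nf

theorem m_neg_one_eq_even_add_odd {x q : ℂ} (hq : q ≠ 0) (hq1 : ‖q‖ < 1) (hx : x ≠ 0) :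
    m x q (-1) = (theta (-1) q)⁻¹ * (evenLerch x q + oddLerch x q) := by
  rw [m_neg_one_eq_tsum, tsum_int_even_add_odd (summable_neg_one_lerch hq hq1 hx)]
  simp only [tri_two_mul, tri_two_mul_add_one]
  rfl

/-- The expansion of the reciprocal theta function differs from the series of `m x q (-1)` only by
the sign `(-1)^r`, which separates the parities. -/
theorem inv_theta_eq_even_sub_odd {x q : ℂ} (hq : q ≠ 0) (hq1 : ‖q‖ < 1) (hx : x ≠ 0)
    (h : ∀ k : ℤ, x ≠ -q ^ k) :
    qPochInf q q ^ 3 / theta (-x) q = evenLerch x q - oddLerch x q := by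
  have h1 : ∀ k : ℤ, -x * q ^ k ≠ 1 := fun k hk => h (-k) (by
    rw [zpow_neg, ← eq_inv_of_mul_eq_one_left hk, neg_neg])
  rw [inv_theta_eq_tsum hq hq1 (neg_ne_zero.mpr hx) h1, tsum_int_even_add_odd]
  · simp only [tri_two_mul, tri_two_mul_add_one, neg_one_zpow_two_mul, neg_one_zpow_two_mul_add_one,
      one_mul, neg_mul, neg_neg, neg_div, tsum_neg, evenLerch, oddLerch, sub_eq_add_neg]
  · simpa using (summable_lerch hq hq1 (neg_ne_zero.mpr hx) one_ne_zero (e := 1) one_pos).of_norm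

theorem J_term_eq {x q : ℂ} (hq : q ≠ 0) (hq1 : ‖q‖ < 1) (hx : x ≠ 0) (h : ∀ k : ℤ, x ≠ -q ^ k) :
    J 1 2 q ^ 2 / (2 * theta (-x) q) = (theta (-1) q)⁻¹ * (evenLerch x q - oddLerch x q) := by
  rw [← inv_theta_eq_even_sub_odd hq hq1 hx h, J_one_two_sq hq hq1]
  field_simp

/-- When `z² = -q/x`, inversion and `z ↦ q/z` reduce the theta functions in `m_sub_m` to `j(z)`,
`j(-z)`, `j(-1)` and `j(-x)`; the first two cancel, so the choice of root is immaterial. -/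
theorem m_neg_one_sub_m_sqrt {x q z : ℂ} (hq : q ≠ 0) (hq1 : ‖q‖ < 1) (hx : x ≠ 0)
    (h : ∀ k : ℤ, x ≠ -q ^ k) (hz : z ^ 2 = -q / x) :
    m x q (-1) - m x q z = J 1 2 q ^ 2 / (2 * theta (-x) q) := by
  have hz0 : z ≠ 0 := by
    rintro rfl
    have : -q / x ≠ 0 := div_ne_zero (neg_ne_zero.mpr hq) hx
    exact this (by rw [← hz]; simp)
  have hxz : x * z ^ 2 = -q := by rw [hz]; field_simp
  -- If `z² = q^(2k)`, then `x = -q^(1-2k)`, which is excluded. Thus neither `z` nor `-z` is a power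
  -- of `q`, and `z x = -q/z` avoids the poles too.
  have hsq : ∀ k : ℤ, z ^ 2 ≠ (q ^ k) ^ 2 := fun k hk => h (1 - 2 * k) (by
    have h1 : q ^ k ≠ 0 := zpow_ne_zero _ hq
    rw [zpow_sub₀ hq, zpow_one, mul_comm 2 k, zpow_mul, ← neg_div, eq_div_iff (zpow_ne_zero _ h1), ← hxz,
      hk]
    norm_cast)
  have z1 : ∀ k : ℤ, z ≠ -1 * q ^ k := fun k hk => hsq k (by rw [hk]; ring)
  have z2 : ∀ k : ℤ, z ≠ q ^ k := fun k hk => hsq k (by rw [hk])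
  have z3 : ∀ k : ℤ, (-1 : ℂ) ≠ q ^ k := fun k hk => by
    have h0 := zpow_inj hq hq1 (m := k) (n := 0) (by rw [← hk]; simp)
    subst h0
    norm_num at hk
  have hzx : z * x = -q / z := by
    rw [eq_div_iff hz0]
    linear_combination hxz
  have z4 : ∀ k : ℤ, z * x * q ^ k ≠ 1 := fun k hk => z1 (k + 1) (by
    rw [hzx] at hk
    rw [zpow_add_one₀ hq]
    field_simp at hk
    linear_combination -hk)
  have z5 : ∀ k : ℤ, -1 * x * q ^ k ≠ 1 := fun k hk => h (-k) (by
    rw [zpow_neg, ← eq_inv_of_mul_eq_one_left hk]; ring)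
  rw [m_sub_m hq hq1 hx hz0 (by norm_num) z1 z2 z3 z4 z5, hzx, J_one_two_sq hq hq1,
    show z * -1 * x = q / z by linear_combination -hzx, theta_div hq,
    show -q / z = q / -z by rw [div_neg, neg_div], theta_div hq, neg_one_mul,
    show (-1 : ℂ) / z = (-z)⁻¹ by field_simp, theta_inv hq hq1 (neg_ne_zero.mpr hz0)]
  have n1 : theta z q ≠ 0 := theta_ne_zero hz0 hq hq1 z2
  have n2 : theta (-z) q ≠ 0 := theta_ne_zero (neg_ne_zero.mpr hz0) hq hq1 fun k hk =>
    z1 k (by rw [← hk]; ring)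
  field_simp

/-! ### The starred sum -/

theorem summable_starTerm {x q : ℂ} (hq : q ≠ 0) (hq1 : ‖q‖ < 1) (hx : x ≠ 0) :
    Summable (starTerm x q) := by
  obtain ⟨C, hC, hC'⟩ := exists_inv_one_sub_le hq hq1 (neg_ne_zero.mpr hx)
  obtain ⟨D, hD, hD'⟩ := exists_inv_one_sub_le hq hq1 (neg_ne_zero.mpr (inv_ne_zero hx))
  refine Summable.of_norm_bounded (((summable_zpow_tri (norm_pos_iff.mpr hq) hq1 one_pos).mul_left
    ‖1 + 1 / x‖).mul_right (C * D)) fun n => ?_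
  have h1 : starTerm x q n
      = (1 + 1 / x) * q ^ tri n * ((1 - -x * q ^ n)⁻¹ * (1 - -x⁻¹ * q ^ n)⁻¹) := by
    rw [starTerm, div_eq_mul_inv, mul_inv, tri]
    ring_nf
  rw [h1, norm_mul, norm_mul, norm_mul, norm_zpow, one_zpow, one_mul]
  gcongr
  · exact hC' n
  · exact hD' n

theorem tsum_add_neg {f : ℤ → ℂ} (hf : Summable f) : ∑' n, (f n + f (-n)) = 2 * ∑' n, f n :=
  calc ∑' n, (f n + f (-n)) = ∑' n, f n + ∑' n, f (Equiv.neg ℤ n) :=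
        hf.tsum_add ((Equiv.neg ℤ).summable_iff.mpr hf)
    _ = 2 * ∑' n, f n := by rw [(Equiv.neg ℤ).tsum_eq f, two_mul]

/-- The two general terms differ, but their even parts in `n` agree: with `y = q^n`, both
symmetrised terms equal `q^(tri n) (1 + x)(1 + y) / ((1 + xy)(x + y))`. -/
theorem starSum_eq {x q : ℂ} (hq : q ≠ 0) (hq1 : ‖q‖ < 1) (hx : x ≠ 0) (h : ∀ k : ℤ, x ≠ -q ^ k) :
    starSum x q = m x q (-1) := by
  have hn : ∀ n : ℤ, 1 + x * q ^ n ≠ 0 := fun n hk => h (-n) (by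
    have h1 := zpow_ne_zero n hq
    rw [zpow_neg, eq_neg_iff_add_eq_zero]
    field_simp
    linear_combination hk)
  have s1 := summable_starTerm hq hq1 hx
  have s2 := summable_neg_one_lerch hq hq1 hx
  have h1 : ∑' n, starTerm x q n = ∑' r : ℤ, q ^ tri r / (1 + x * q ^ r) := by
    have h2 : ∑' n, (starTerm x q n + starTerm x q (-n))
        = ∑' n : ℤ, (q ^ tri n / (1 + x * q ^ n) + q ^ tri (-n) / (1 + x * q ^ (-n))) := by
      congr 1
      funext n
      have h3 := hn n
      have h4 := hn (-n)
      have h5 := zpow_ne_zero n hq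
      rw [starTerm, starTerm]
      change (1 + 1 / x) * q ^ tri n / _ + (1 + 1 / x) * q ^ tri (-n) / _ = _
      rw [tri_neg, zpow_sub₀ hq]
      rw [zpow_neg] at h4 ⊢
      generalize q ^ n = y at *
      have h6 : x + y ≠ 0 := fun h7 => h4 (by field_simp; linear_combination h7)
      have h7 : y + x ≠ 0 := by rwa [add_comm]
      have h8 : y * x + 1 ≠ 0 := fun h7 => h3 (by linear_combination h7)
      have h9 : x * y + 1 ≠ 0 := fun h7 => h3 (by linear_combination h7)
      have h10 : 1 + y * x ≠ 0 := fun h7 => h3 (by linear_combination h7)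
      field_simp
      ring
    rw [tsum_add_neg s1, tsum_add_neg s2] at h2
    exact mul_left_cancel₀ two_ne_zero h2
  rw [starSum, h1, m_neg_one_eq_tsum, Jbar, zpow_zero, pow_one, one_div]

/-! ### Theta functions in base `q ^ 4` and the remaining evaluations of the even half -/

theorem four_zpow (q : ℂ) (k : ℤ) : (q ^ 4) ^ k = q ^ (4 * k) := by
  rw [← zpow_natCast, ← zpow_mul]; rfl

theorem theta_neg_four {q : ℂ} (hq : q ≠ 0) (hq1 : ‖q‖ < 1) :
    theta (-q) (q ^ 4) = qPochInf (-q) (q ^ 2) * qPochInf (q ^ 4) (q ^ 4) := by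
  have h := qPochInf_even_mul_odd (norm_pow_lt_one hq1 two_ne_zero) (-q)
  rw [← pow_mul] at h
  rw [theta, h, show q ^ 4 / -q = q ^ 2 * -q by field_simp]

theorem qPochInf_odd_mul_neg {q : ℂ} (hq1 : ‖q‖ < 1) :
    qPochInf q (q ^ 2) * qPochInf (-q) (q ^ 2) = qPochInf (q ^ 2) (q ^ 4) := by
  rw [qPochInf_mul_neg (norm_pow_lt_one hq1 two_ne_zero), ← pow_mul]

theorem qPochInf_sq_split {q : ℂ} (hq1 : ‖q‖ < 1) :
    qPochInf (q ^ 2) (q ^ 2) = qPochInf (q ^ 2) (q ^ 4) * qPochInf (q ^ 4) (q ^ 4) := by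
  rw [qPochInf_even_mul_odd (norm_pow_lt_one hq1 two_ne_zero) (q ^ 2), ← pow_mul, ← pow_add]

theorem theta_neg_four_inv {q : ℂ} (hq : q ≠ 0) (hq1 : ‖q‖ < 1) :
    (theta (-q) (q ^ 4))⁻¹ = 2 / theta (-1) q := by
  have h2 := qPochInf_self_ne_zero (norm_pow_lt_one hq1 two_ne_zero)
  have h3 := qPochInf_odd_mul_neg hq1
  have h4 := qPochInf_sq_split hq1
  rw [← h3] at h4
  have h5 : qPochInf (-q) (q ^ 2) ≠ 0 := fun h => h2 (by rw [h4, h]; ring)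
  have h6 := qPochInf_self_ne_zero (norm_pow_lt_one hq1 four_ne_zero)
  have h7 := qPochInf_odd_ne_zero hq1
  rw [← odd_div_even_eq hq1, theta_neg_four hq hq1, h4]
  field_simp

/-- Writing `1/(1 + xq^(2r))` as `(1 - xq^(2r)) / (1 - x²q^(4r))` splits the even half into two
Lerch series in `x²`; the factor `1 - xq^(2r)` is why the points `x = q^(2k)` are excluded as well.
-/
theorem evenLerch_eq_m_sub_m {x q : ℂ} (hq : q ≠ 0) (hq1 : ‖q‖ < 1) (hx : x ≠ 0)
    (h : ∀ k : ℤ, x ≠ q ^ (2 * k) ∧ x ≠ -q ^ (2 * k)) :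
    2 / theta (-1) q * evenLerch x q
      = m (-q * x ^ 2) (q ^ 4) (-q⁻¹) - q⁻¹ * x * m (-q⁻¹ * x ^ 2) (q ^ 4) (-q) := by
  have hp1 := norm_pow_lt_one hq1 four_ne_zero
  have hp0 := pow_ne_zero 4 hq
  have hq' := neg_ne_zero.mpr hq
  have hx2 := pow_ne_zero 2 hx
  have e1 : -q * x ^ 2 * -q⁻¹ = x ^ 2 := by field_simp
  have e2 : -q⁻¹ * x ^ 2 * -q = x ^ 2 := by field_simp
  have t : theta (-q⁻¹) (q ^ 4) = q⁻¹ * theta (-q) (q ^ 4) := by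
    have := theta_inv hp0 hp1 hq'
    rwa [inv_neg, neg_neg] at this
  have s1 := (summable_lerch hp0 hp1 hx2 (neg_ne_zero.mpr (inv_ne_zero hq)) (e := 1) one_pos).of_norm
  have s2 := (summable_lerch hp0 hp1 hx2 hq' (e := 1) one_pos).of_norm
  simp only [mul_one] at s1 s2
  have hθ : theta (-q) (q ^ 4) ≠ 0 := fun h0 => by
    have := theta_neg_four_inv hq hq1
    rw [h0, inv_zero] at this
    exact div_ne_zero two_ne_zero (theta_neg_one_ne_zero hq1) this.symm
  have h1 : m (-q * x ^ 2) (q ^ 4) (-q⁻¹) - q⁻¹ * x * m (-q⁻¹ * x ^ 2) (q ^ 4) (-q)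
      = (theta (-q) (q ^ 4))⁻¹ * (∑' r : ℤ, (-1) ^ r * (q ^ 4) ^ tri r * (-q⁻¹) ^ r / (1 - x ^ 2 * (q ^ 4) ^ r)
        - x * ∑' r : ℤ, (-1) ^ r * (q ^ 4) ^ tri r * (-q) ^ r / (1 - x ^ 2 * (q ^ 4) ^ r)) := by
    rw [m_eq _ _ (neg_ne_zero.mpr (inv_ne_zero hq)), m_eq _ _ hq', e1, e2, t]
    field_simp
  rw [h1, theta_neg_four_inv hq hq1, ← tsum_mul_left, ← s1.tsum_sub (s2.mul_left x), evenLerch]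
  congr 2
  funext r
  have n1 : 1 + x * q ^ (2 * r) ≠ 0 := fun hk => (h (-r)).2 (by
    have h2 := zpow_ne_zero (2 * r) hq
    rw [mul_neg, zpow_neg, eq_neg_iff_add_eq_zero]
    field_simp
    linear_combination hk)
  have n2 : 1 - x * q ^ (2 * r) ≠ 0 := fun hk => (h (-r)).1 (by
    have h2 := zpow_ne_zero (2 * r) hq
    rw [mul_neg, zpow_neg, ← sub_eq_zero]
    field_simp
    linear_combination -hk)
  have e3 : (-q⁻¹) ^ r = (-1) ^ r * q ^ (-r) := by
    rw [show -q⁻¹ = -1 * q⁻¹ by ring, mul_zpow, inv_zpow']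
  have e4 : (-q) ^ r = (-1) ^ r * q ^ r := by
    rw [show -q = -1 * q by ring, mul_zpow]
  have e5 : (q ^ 4) ^ tri r = q ^ (2 * r ^ 2 + r) * q ^ r := by
    rw [four_zpow, ← zpow_add₀ hq]
    congr 1
    linear_combination 2 * two_mul_tri r
  have e6 : (q ^ 4) ^ r = q ^ (2 * r) * q ^ (2 * r) := by
    rw [four_zpow, ← zpow_add₀ hq]
    congr 1
    ring
  have e7 : q ^ (2 * r) = q ^ r * q ^ r := by rw [two_mul, zpow_add₀ hq]
  have e8 : 1 - x ^ 2 * (q ^ (2 * r) * q ^ (2 * r)) = (1 - x * q ^ (2 * r)) * (1 + x * q ^ (2 * r)) := by ring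
  have e9 : q ^ r * q ^ (-r) = 1 := by rw [← zpow_add₀ hq, add_neg_cancel, zpow_zero]
  rw [e3, e4, e5, e6, e8, mul_div_assoc', div_sub_div_same, eq_div_iff (mul_ne_zero n2 n1),
    div_mul_eq_mul_div, div_eq_iff n1]
  have e10 := neg_one_zpow_mul_self r
  rw [e7]
  linear_combination (-(q ^ (2 * r ^ 2 + r) * (1 + x * (q ^ r * q ^ r)))) *
    ((q ^ r * q ^ (-r) - x * q ^ r * q ^ r) * e10 + e9)

theorem theta_four_mul_theta_four {q x : ℂ} (hq : q ≠ 0) (hq1 : ‖q‖ < 1) (hx : x ≠ 0) :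
    theta (q * x) (q ^ 4) * theta (q ^ 3 * x) (q ^ 4) * qPochInf (q ^ 2) (q ^ 2)
      = theta (x * q) (q ^ 2) * qPochInf (q ^ 4) (q ^ 4) ^ 2 := by
  have hp1 := norm_pow_lt_one hq1 two_ne_zero
  have h1 := qPochInf_even_mul_odd hp1 (x * q)
  have h2 := qPochInf_even_mul_odd hp1 (q ^ 2 / (x * q))
  rw [← pow_mul] at h1 h2
  rw [theta, theta, theta, h1, h2, show q ^ 2 * (x * q) = q ^ 3 * x by ring, mul_comm x q,
    show q ^ 2 * (q ^ 2 / (q * x)) = q ^ 4 / (q * x) by ring,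
    show q ^ 4 / (q ^ 3 * x) = q ^ 2 / (q * x) by field_simp]
  ring

/-- Expand `j(-q²x;q⁴) / (j(-x;q⁴) j(qx;q⁴) j(q³x;q⁴))` in partial fractions. The poles of
`j(-x;q⁴)` give the even half in base `q ^ 2`; those of the other two factors give the even and odd
indices of `m x (q ^ 2) q`. -/
theorem evenLerch_sq_eq {q x : ℂ} (hq : q ≠ 0) (hq1 : ‖q‖ < 1) (hx : x ≠ 0)
    (h : ∀ k : ℤ, x ≠ -q ^ (4 * k) ∧ x ≠ q ^ (2 * k + 1)) :
    2 / theta (-1) (q ^ 2) * evenLerch x (q ^ 2)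
      = m x (q ^ 2) q + Jbar 1 4 q ^ 2 * theta (-x * q ^ 2) (q ^ 4) /
        (theta (-x) (q ^ 4) * theta (x * q) (q ^ 2)) := by
  have hp1 := norm_pow_lt_one hq1 four_ne_zero
  have hp0 := pow_ne_zero 4 hq
  have hs1 := norm_pow_lt_one hq1 two_ne_zero
  have hs0 := pow_ne_zero 2 hq
  have hdist : ∀ i j : Fin 3, i ≠ j → ∀ k : ℤ,
      (![-1, q, q ^ 3] : Fin 3 → ℂ) i ≠ (![-1, q, q ^ 3] : Fin 3 → ℂ) j * (q ^ 4) ^ k := by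
    -- The pole families are disjoint because their absolute values are powers of `‖q‖` with
    -- exponents `0`, `1`, `3` modulo `4`.
    have hn : ∀ i : Fin 3, ‖(![-1, q, q ^ 3] : Fin 3 → ℂ) i‖ = ‖q ^ ((![0, 1, 3] : Fin 3 → ℤ) i)‖ := by
      intro i
      fin_cases i <;> simp
    intro i j hij k hk
    have h1 := congrArg norm hk
    rw [norm_mul, hn, hn, ← norm_mul, four_zpow, ← zpow_add₀ hq] at h1
    have h2 := zpow_inj hq hq1 h1
    fin_cases i <;> fin_cases j <;> simp at hij h2 <;> omega
  have hax : ∀ (i : Fin 3) (k : ℤ), (![-1, q, q ^ 3] : Fin 3 → ℂ) i * x * (q ^ 4) ^ k ≠ 1 := by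
    intro i k hk
    rw [four_zpow] at hk
    have hk0 := zpow_ne_zero (4 * k) hq
    fin_cases i
    · refine (h (-k)).1 ?_
      rw [mul_neg, zpow_neg, eq_neg_iff_add_eq_zero]
      field_simp
      simp at hk
      linear_combination -hk
    · refine (h (-(2 * k + 1))).2 ?_
      rw [show 2 * -(2 * k + 1) + 1 = -(4 * k + 1) by ring, zpow_neg, zpow_add_one₀ hq]
      refine eq_inv_of_mul_eq_one_left ?_
      simp at hk
      linear_combination hk
    · refine (h (-(2 * k + 2))).2 ?_
      rw [show 2 * -(2 * k + 2) + 1 = -(4 * k + 3) by ring, zpow_neg, zpow_add₀ hq]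
      refine eq_inv_of_mul_eq_one_left ?_
      simp at hk
      norm_cast at hk ⊢
      linear_combination hk
  have key := theta_partial_fractions (ι := Fin 3) (κ := Unit) hp0 hp1 (a := ![-1, q, q ^ 3])
    (b := fun _ => -q ^ 2) (by intro i; fin_cases i <;> simp [hq]) (by simp [hq]) (by simp) hdist hx hax
  have e0 : (Finset.univ.erase (0 : Fin 3)) = {1, 2} := by decide
  have e1 : (Finset.univ.erase (1 : Fin 3)) = {0, 2} := by decide
  have e2 : (Finset.univ.erase (2 : Fin 3)) = {0, 1} := by decide
  have d0 : (1 : Fin 3) ≠ 2 := by decide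
  have d1 : (0 : Fin 3) ≠ 2 := by decide
  have d2 : (0 : Fin 3) ≠ 1 := by decide
  simp only [Fin.sum_univ_three, Fin.prod_univ_three, e0, e1, e2, Finset.prod_pair d0,
    Finset.prod_pair d1, Finset.prod_pair d2, Finset.prod_singleton, Finset.univ_unique,
    Matrix.cons_val_zero, Matrix.cons_val_one, Matrix.cons_val, Fintype.card_fin, Fintype.card_unit]
    at key
  have hq' := neg_ne_zero.mpr hq
  have t1 : theta (-q ^ 3) (q ^ 4) = theta (-q) (q ^ 4) := by
    rw [← theta_div hp0 (x := -q), show q ^ 4 / -q = -q ^ 3 by field_simp]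
  have t2 : theta (-1 / q) (q ^ 4) = q⁻¹ * theta (-q) (q ^ 4) := by
    have := theta_inv hp0 hp1 hq'
    rwa [inv_neg, neg_neg, ← one_div, ← neg_div, one_div] at this
  have t3 : theta (-1 / q ^ 3) (q ^ 4) = (q ^ 3)⁻¹ * theta (-q) (q ^ 4) := by
    have := theta_inv hp0 hp1 (neg_ne_zero.mpr (pow_ne_zero 3 hq))
    rwa [inv_neg, neg_neg, ← one_div, ← neg_div, one_div, t1] at this
  have t4 : theta (q / q ^ 3) (q ^ 4) = -(q ^ 2)⁻¹ * theta (q ^ 2) (q ^ 4) := by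
    rw [show q / q ^ 3 = (q ^ 2)⁻¹ by field_simp, theta_inv hp0 hp1 hs0]
  rw [show -q ^ 2 / -1 = q ^ 2 by ring, show q / -1 = -q by ring, show q ^ 3 / -1 = -q ^ 3 by ring,
    show -q ^ 2 / q = -q by field_simp, show q ^ 3 / q = q ^ 2 by field_simp,
    show -q ^ 2 / q ^ 3 = -1 / q by field_simp, t1, t2, t3, t4,
    -- These are the bases of the `r`th powers in the three Lerch series.
    show -q ^ 2 / (- -q * - -q ^ 3) = -(q ^ 2)⁻¹ by field_simp,
    show - -q / (-(-1 / q) * -q ^ 2) = -1 by field_simp,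
    show -(-1 / q) / (-(-1 / q ^ 3) * -(q / q ^ 3)) = -q ^ 4 by field_simp,
    show (((3 : ℕ) : ℤ) - ((1 : ℕ) : ℤ)) = 2 by norm_num] at key
  have s0 : evenLerch x (q ^ 2) = ∑' r : ℤ, (-1) ^ r * (q ^ 4) ^ (tri r * 2) * (-(q ^ 2)⁻¹) ^ r /
      (1 - -1 * x * (q ^ 4) ^ r) := by
    rw [evenLerch]
    congr 1
    funext r
    rw [show -(q ^ 2)⁻¹ = -1 * (q ^ 2)⁻¹ by ring, mul_zpow, mul_mul_mul_comm, ← mul_assoc,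
      neg_one_zpow_mul_self, one_mul, inv_zpow', sq_zpow, sq_zpow, sq_zpow, four_zpow, four_zpow,
      ← zpow_add₀ hq]
    congr 1
    · congr 1
      linear_combination -4 * two_mul_tri r
    · rw [show 2 * (2 * r) = 4 * r by ring]
      ring
  have hm := m_eq x (q ^ 2) hq
  rw [tsum_int_even_add_odd (by
    simpa using (summable_lerch hs0 hs1 (mul_ne_zero hx hq) hq (e := 1) one_pos).of_norm)] at hm
  have s1 : ∑' r : ℤ, (-1) ^ (2 * r) * (q ^ 2) ^ tri (2 * r) * q ^ (2 * r) /
      (1 - x * q * (q ^ 2) ^ (2 * r))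
      = ∑' r : ℤ, (-1) ^ r * (q ^ 4) ^ (tri r * 2) * (-1) ^ r / (1 - q * x * (q ^ 4) ^ r) := by
    congr 1
    funext r
    rw [neg_one_zpow_two_mul, one_mul, mul_right_comm ((-1 : ℂ) ^ r), neg_one_zpow_mul_self, one_mul, sq_zpow, sq_zpow,
      four_zpow, four_zpow, ← zpow_add₀ hq, mul_comm x q, show 2 * (2 * r) = 4 * r by ring, tri_two_mul]
    congr 2
    linear_combination -4 * two_mul_tri r
  have s2 : ∑' r : ℤ, (-1) ^ (2 * r + 1) * (q ^ 2) ^ tri (2 * r + 1) * q ^ (2 * r + 1) /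
      (1 - x * q * (q ^ 2) ^ (2 * r + 1))
      = -q ^ 3 * ∑' r : ℤ, (-1) ^ r * (q ^ 4) ^ (tri r * 2) * (-q ^ 4) ^ r /
        (1 - q ^ 3 * x * (q ^ 4) ^ r) := by
    rw [← tsum_mul_left]
    congr 1
    funext r
    have n1 : (q ^ 2) ^ tri (2 * r + 1) * q ^ (2 * r + 1) = q ^ 3 * ((q ^ 4) ^ (tri r * 2) * (q ^ 4) ^ r) := by
      rw [sq_zpow, four_zpow, four_zpow, ← zpow_natCast q 3, ← zpow_add₀ hq, ← zpow_add₀ hq,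
        ← zpow_add₀ hq, tri_two_mul_add_one]
      congr 1
      push_cast
      linear_combination -4 * two_mul_tri r
    have n2 : x * q * (q ^ 2) ^ (2 * r + 1) = q ^ 3 * x * (q ^ 4) ^ r := by
      rw [sq_zpow, four_zpow, show 2 * (2 * r + 1) = 2 + 4 * r by ring, zpow_add₀ hq]
      norm_cast
      ring
    rw [neg_one_zpow_two_mul_add_one, mul_assoc, n1, n2, show -q ^ 4 = -1 * q ^ 4 by ring, mul_zpow,
      mul_mul_mul_comm, neg_one_zpow_mul_self]
    ring
  rw [← s0] at key
  rw [s1, s2] at hm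
  generalize ∑' r : ℤ, (-1) ^ r * (q ^ 4) ^ (tri r * 2) * (-1) ^ r / (1 - q * x * (q ^ 4) ^ r) = S1 at *
  generalize ∑' r : ℤ, (-1) ^ r * (q ^ 4) ^ (tri r * 2) * (-q ^ 4) ^ r /
        (1 - q ^ 3 * x * (q ^ 4) ^ r) = S2 at *
  have c1 := qPochInf_sq_split hq1
  have c2 := qPochInf_odd_mul_neg hq1
  have c3 := theta_neg_four hq hq1
  have c4 := theta_self_sq hq
  have c5 := theta_self_sq hs0
  have c6 := odd_div_even_eq hs1
  rw [← pow_mul] at c5 c6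
  have c7 := theta_four_mul_theta_four hq hq1 hx
  have c8 := qPochInf_self_ne_zero hp1
  have c9 := qPochInf_self_ne_zero hs1
  have c10 := qPochInf_odd_ne_zero hq1
  have c11 : qPochInf (-q) (q ^ 2) ≠ 0 := fun h0 => c9 (by rw [c1, ← c2, h0]; ring)
  have c12 : theta (x * q) (q ^ 2)
      = theta (q * x) (q ^ 4) * theta (q ^ 3 * x) (q ^ 4) * qPochInf (q ^ 2) (q ^ 2) /
        qPochInf (q ^ 4) (q ^ 4) ^ 2 := by
    rw [eq_div_iff (pow_ne_zero 2 c8), c7]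
  have c13 : Jbar 1 4 q ^ 2 * theta (-x * q ^ 2) (q ^ 4) / (theta (-x) (q ^ 4) * theta (x * q) (q ^ 2))
      = theta (-q) (q ^ 4) ^ 2 * qPochInf (q ^ 4) (q ^ 4) ^ 2 / qPochInf (q ^ 2) (q ^ 2) *
        (theta (-q ^ 2 * x) (q ^ 4) /
          (theta (-1 * x) (q ^ 4) * theta (q * x) (q ^ 4) * theta (q ^ 3 * x) (q ^ 4))) := by
    rw [c12, Jbar, zpow_one, show -x * q ^ 2 = -q ^ 2 * x by ring, neg_one_mul]
    field_simp
  norm_num at c5 c6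
  rw [c13, key, hm, ← c6, c4, c5, c3, c1, ← c2]
  field_simp
  ring

theorem term₅_eq (x q : ℂ) : term₅ x q = term₂ x (q ^ 2) := by
  funext n
  rw [term₅, term₂, ← pow_mul, ← pow_mul]

end AppellLerch

/-! ### Assembly of the identities -/

open AppellLerch in
theorem mainTheorem9 (q x : ℂ) (hq0 : q ≠ 0) (hq1 : ‖q‖ < 1) (hx : x ≠ 0) :
    -- first identity
    ((∀ k : ℤ, x ≠ q ^ (2 * k + 1)) →
      Summable (AppellLerch.term₁ x q) ∧
      (1 + x⁻¹) * ∑' n : ℕ, AppellLerch.term₁ x q n = -AppellLerch.m x (q ^ 2) q) ∧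
    -- second identity, first and second expressions
    ((∀ k : ℤ, x ≠ -q ^ k) →
      Summable (AppellLerch.term₂ x q) ∧
      ∑' n : ℕ, AppellLerch.term₂ x q n
        = AppellLerch.m x q (-1)
          + AppellLerch.J 1 2 q ^ 2 / (2 * AppellLerch.theta (-x) q) ∧
      ∀ z : ℂ, z ^ 2 = -q / x →
        ∑' n : ℕ, AppellLerch.term₂ x q n
          = 2 * AppellLerch.m x q (-1) - AppellLerch.m x q z) ∧
    -- second identity, third expression
    ((∀ k : ℤ, x ≠ q ^ (2 * k) ∧ x ≠ -q ^ (2 * k)) →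
      Summable (AppellLerch.term₂ x q) ∧
      ∑' n : ℕ, AppellLerch.term₂ x q n
        = AppellLerch.m (-q * x ^ 2) (q ^ 4) (-q⁻¹)
          - q⁻¹ * x * AppellLerch.m (-q⁻¹ * x ^ 2) (q ^ 4) (-q)) ∧
    -- third identity
    ((∀ k : ℤ, x ≠ -q ^ k) →
      Summable (AppellLerch.starTerm x q) ∧
      AppellLerch.starSum x q = AppellLerch.m x q (-1)) ∧
    -- fourth identity
    ((∀ k : ℤ, x ≠ -q ^ k) →
      Summable (AppellLerch.term₄ x q) ∧
      (1 + 1 / x) * ∑' n : ℕ, AppellLerch.term₄ x q n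
        = AppellLerch.m x q (-1)
          - AppellLerch.J 1 2 q ^ 2 / (2 * AppellLerch.theta (-x) q)) ∧
    -- fifth identity
    ((∀ k : ℤ, x ≠ -q ^ (4 * k) ∧ x ≠ q ^ (2 * k + 1)) →
      Summable (AppellLerch.term₅ x q) ∧
      ∑' n : ℕ, AppellLerch.term₅ x q n
        = AppellLerch.m x (q ^ 2) q
          + AppellLerch.Jbar 1 4 q ^ 2 * AppellLerch.theta (-x * q ^ 2) (q ^ 4)
            / (AppellLerch.theta (-x) (q ^ 4) * AppellLerch.theta (x * q) (q ^ 2))) := by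
  have hs0 := pow_ne_zero 2 hq0
  have hs1 := norm_pow_lt_one hq1 two_ne_zero
  refine ⟨fun h => term₁_hasSum hq0 hq1 hx h, fun h => ?_, fun h => ?_, fun h => ?_, fun h => ?_,
    fun h => ?_⟩
  · obtain ⟨h1, h2⟩ := term₂_hasSum hq0 hq1 hx fun k => h (2 * k)
    have h3 : ∑' n, term₂ x q n = m x q (-1) + J 1 2 q ^ 2 / (2 * theta (-x) q) := by
      rw [h2, m_neg_one_eq_even_add_odd hq0 hq1 hx, J_term_eq hq0 hq1 hx h]
      ring
    refine ⟨h1, h3, fun z hz => ?_⟩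
    rw [h3, ← m_neg_one_sub_m_sqrt hq0 hq1 hx h hz]
    ring
  · obtain ⟨h1, h2⟩ := term₂_hasSum hq0 hq1 hx fun k => (h k).2
    exact ⟨h1, h2.trans (evenLerch_eq_m_sub_m hq0 hq1 hx h)⟩
  · exact ⟨summable_starTerm hq0 hq1 hx, starSum_eq hq0 hq1 hx h⟩
  · obtain ⟨h1, h2⟩ := term₄_hasSum hq0 hq1 hx fun k => h (2 * k + 1)
    refine ⟨h1, ?_⟩
    rw [h2, m_neg_one_eq_even_add_odd hq0 hq1 hx, J_term_eq hq0 hq1 hx h]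
    ring
  · have h0 : ∀ k : ℤ, x ≠ -(q ^ 2) ^ (2 * k) := fun k => by
      rw [sq_zpow, ← mul_assoc]
      exact (h k).1
    obtain ⟨h1, h2⟩ := term₂_hasSum hs0 hs1 hx h0
    rw [term₅_eq]
    exact ⟨h1, h2.trans (evenLerch_sq_eq hq0 hq1 hx h)⟩
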